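/- Let $\mathcal X,\mathcal Y,\mathcal Z$ be finite alphabets, let $Q_X$ be a distribution on $\mathcal X$ and $Q_{YZ|X}$ a channel from $\mathcal X$ to $\mathcal Y\times\mathcal Z$, and put $Q=Q_XQ_{YZ|X}$. All information quantities are in bits, and $[2^{a}]$ denotes $\{1,\dots,\lfloor 2^{a}\rfloor\}$. Below, $A-B-C$ denotes a Markov chain. **Problem.** For rates $R_0,R_1,R_2\ge 0$, a $(2^{nR_0},2^{nR_1},2^{nR_2},n)$ cascade channel synthesis code consists of a randomized map $(X^n,K)\mapsto J_1\in[2^{nR_1}]$ at node 1, a randomized map $(J_1,K)\mapsto (J_2,Y^n)\in[2^{nR_2}]\times\mathcal Y^n$ at node 2 ($J_2$ and $Y^n$ may use the same local randomness), and a randomized map $(J_2,K)\mapsto Z^n\in\mathcal Z^n$ at node 3; the local randomness of the three nodes is mutually independent and independent of $(X^n,K)$. Here $X^n$ is i.i.d. with law $Q_X$, and $K$ is uniform on $[2^{nR_0}]$ and independent of $X^n$. The triple $(R_0,R_1,R_2)$ is achievable (without an eavesdropper) if there is a sequence of such codes, $n\ge1$, whose induced distributions satisfy $$\lim_{n\to\infty}\Big\|P_{X^nY^nZ^n}-\prod_{t=1}^nQ(x_t,y_t,z_t)\Big\|_{TV}=0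 .$$ Let $\mathcal C_0$ be the closure of the set of achievable triples. **Inner bound.** Let $D$ be the set of joint distributions $P_{X,Y,Z,U,V}$ on $\mathcal X\times\mathcal Y\times\mathcal Z\times\mathcal U\times\mathcal V$ with $(X,Y,Z)\sim Q$, $X-(U,V)-Y$, $(X,Y,U)-V-Z$, $|\mathcal V|\le|\mathcal X||\mathcal Y||\mathcal Z|+3$ and $|\mathcal U|\le|\mathcal X||\mathcal Y||\mathcal Z||\mathcal V|+2$. Let $\mathcal S_0$ be the set of $(R_0,R_1,R_2)\in\mathbb R^3$ with $R_0\ge0$ for which some $P_{X,Y,Z,U,V}\in D$ satisfies $$R_1\ge I(X;U,V),\quad R_2\ge I(X;V),\quad R_1+R_0\ge I(X,Y,Z;U,V),\quad R_2+R_0\ge I(X,Y,Z;V).$$ **Theorem.** 1. $\mathcal S_0\subseteq\mathcal C_0$ for all $Q_X$ and $Q_{YZ|X}$. 2. Suppose that $X$ is independent of $(Y,Z)$ under $Q$. If $V$ is any random variable with a finite alphabet, jointly distributed with $(Y,Z)\sim Q_{YZ}$, such that $Y-V-Z$, then every $(R_0,R_1,R_2)$ with $R_0,R_1,R_2\ge0$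 and $R_2+R_0\ge I(Y,Z;V)$ belongs to $\mathcal C_0$. 3. Suppose that $X$ is independent of $(Y,Z)$ under $Q$, but $Y$ and $Z$ are dependent. Then there is $R_2>0$ such that $(0,0,R_2)\in\mathcal C_0$, while no joint distribution of $(X,Y,Z,U,V)$ with $(X,Y,Z)\sim Q$, $X-(U,V)-Y$ and $(X,Y,U)-V-Z$ satisfies the four rate constraints above at $(0,0,R_2)$, even with arbitrary finite alphabets for $U$ and $V$. 4. In particular the inner bound is not optimal: there are binary alphabets $\mathcal X=\mathcal Y=\mathcal Z=\{0,1\}$ and $Q_X,Q_{YZ|X}$, with $X$ independent of $(Y,Z)$, for which $\mathcal S_0\subsetneq\mathcal C_0$. -/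

import Mathlib

open Filter Topology

noncomputable section

namespace CascadeSynthesis

/-- Probability distributions on a finite alphabet, as real-valued mass functions. -/
abbrev Law (α : Type*) [Fintype α] : Type _ := stdSimplex ℝ α

/-- Distribution of the random variable `f` when the sample point has mass function `P`. -/
def marg {Ω A : Type*} [Fintype Ω] (P : Ω → ℝ) (f : Ω → A) (a : A) : ℝ :=
  open Classical in ∑ ω, if f ω = a then P ω else 0

/-- Independence of the random variables `f` and `g` under the mass function `P`. -/
def Indep {Ω A B : Type*} [Fintype Ω] (P : Ω → ℝ) (f : Ω → A) (g : Ω → B) : Prop :=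
  ∀ a b, marg P (fun ω => (f ω, g ω)) (a, b) = marg P f a * marg P g b

/-- The Markov chain `f - g - h` under `P`, i.e. `P_{fgh} = P_{fg} P_{h|g}`,
with the denominator of the conditional probability cleared. -/
def MarkovChain {Ω A B C : Type*} [Fintype Ω] (P : Ω → ℝ)
    (f : Ω → A) (g : Ω → B) (h : Ω → C) : Prop :=
  ∀ a b c, marg P (fun ω => (f ω, g ω, h ω)) (a, b, c) * marg P g b =
    marg P (fun ω => (f ω, g ω)) (a, b) * marg P (fun ω => (g ω, h ω)) (b, c)

/-- Mutual information `I(f; g)` in bits under `P`. A pair `(a, b)` of mass zero contributes `0`. -/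
def mutualInfo {Ω A B : Type*} [Fintype Ω] [Fintype A] [Fintype B] (P : Ω → ℝ)
    (f : Ω → A) (g : Ω → B) : ℝ :=
  ∑ a, ∑ b, marg P (fun ω => (f ω, g ω)) (a, b) *
    Real.logb 2 (marg P (fun ω => (f ω, g ω)) (a, b) / (marg P f a * marg P g b))

/-- Total variation distance of two mass functions. -/
def tvDist {α : Type*} [Fintype α] (P Q : α → ℝ) : ℝ := (1 / 2) * ∑ a, |P a - Q a|

section Model

variable {X Y Z : Type*} [Fintype X] [Fintype Y] [Fintype Z]

/-- The target distribution `Q_X Q_{YZ|X}` on triples `(x, y, z)`. -/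
def targetLaw (QX : Law X) (W : X → Law (Y × Z)) (t : X × Y × Z) : ℝ :=
  QX t.1 * W t.1 t.2

/-- The `n`-fold product of the target distribution, on triples of sequences `(xⁿ, yⁿ, zⁿ)`. -/
def iidLaw (QX : Law X) (W : X → Law (Y × Z)) (n : ℕ)
    (s : (Fin n → X) × (Fin n → Y) × (Fin n → Z)) : ℝ :=
  ∏ t, targetLaw QX W (s.1 t, s.2.1 t, s.2.2 t)

end Model

/-- A cascade channel synthesis code of block length `n`, with `M₀` values of the common randomness
and `M₁`, `M₂` values of the two messages. A randomized map is a map into distributions (fresh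
local randomness at each node). Node 2 produces its message `J₂` and its output `Yⁿ` jointly from
`(J₁, K)`: both may depend on the same local randomness of node 2. -/
structure Code (X Y Z : Type*) [Fintype X] [Fintype Y] [Fintype Z] (M₀ M₁ M₂ n : ℕ) where
  /-- Node 1: `(Xⁿ, K) ↦ J₁`. -/
  node1 : (Fin n → X) → Fin M₀ → Law (Fin M₁)
  /-- Node 2: `(J₁, K) ↦ (J₂, Yⁿ)`. -/
  node2 : Fin M₁ → Fin M₀ → Law (Fin M₂ × (Fin n → Y))
  /-- Node 3: `(J₂, K) ↦ Zⁿ`. -/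
  node3 : Fin M₂ → Fin M₀ → Law (Fin n → Z)

section Regions

variable {X Y Z : Type*} [Fintype X] [Fintype Y] [Fintype Z]

/-- The induced joint distribution of `(Xⁿ, Yⁿ, Zⁿ, K, J₁, J₂)`: the source is i.i.d. `Q_X`, and
`K` is uniform and independent of the source. -/
def Code.inducedLaw {M₀ M₁ M₂ n : ℕ} (c : Code X Y Z M₀ M₁ M₂ n) (QX : Law X)
    (x : Fin n → X) (y : Fin n → Y) (z : Fin n → Z)
    (k : Fin M₀) (j₁ : Fin M₁) (j₂ : Fin M₂) : ℝ :=
  (∏ t, QX (x t)) * (1 / (M₀ : ℝ)) * c.node1 x k j₁ * c.node2 j₁ k (j₂, y) * c.node3 j₂ k z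

/-- The induced marginal distribution of `(Xⁿ, Yⁿ, Zⁿ)`. -/
def Code.outputLaw {M₀ M₁ M₂ n : ℕ} (c : Code X Y Z M₀ M₁ M₂ n) (QX : Law X)
    (s : (Fin n → X) × (Fin n → Y) × (Fin n → Z)) : ℝ :=
  ∑ k, ∑ j₁, ∑ j₂, c.inducedLaw QX s.1 s.2.1 s.2.2 k j₁ j₂

/-- Size of the alphabet `[2^{nR}]`. -/
def alphabetSize (n : ℕ) (R : ℝ) : ℕ := ⌊(2 : ℝ) ^ ((n : ℝ) * R)⌋₊

/-- Achievability of the rate triple `R = (R₀, R₁, R₂)` without an eavesdropper: only the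
distribution of `(Xⁿ, Yⁿ, Zⁿ)` has to approach the i.i.d. target in total variation. -/
def Achievable (QX : Law X) (W : X → Law (Y × Z)) (R : ℝ × ℝ × ℝ) : Prop :=
  0 ≤ R.1 ∧ 0 ≤ R.2.1 ∧ 0 ≤ R.2.2 ∧
    ∃ c : ∀ n : ℕ, Code X Y Z (alphabetSize n R.1) (alphabetSize n R.2.1) (alphabetSize n R.2.2) n,
      Tendsto (fun n => tvDist ((c n).outputLaw QX) (iidLaw QX W n)) atTop (𝓝 0)

/-- The synthesis rate region without an eavesdropper: the closure of the achievable triples. -/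
def synthesisRegion (QX : Law X) (W : X → Law (Y × Z)) : Set (ℝ × ℝ × ℝ) :=
  closure {R | Achievable QX W R}

/-- Joint distributions of `(X, Y, Z, U, V)` with `(X, Y, Z) ∼ Q_X Q_{YZ|X}`, `X - (U, V) - Y`
and `(X, Y, U) - V - Z`. -/
def auxLaws (QX : Law X) (W : X → Law (Y × Z)) (U V : Type*) [Fintype U] [Fintype V] :
    Set (Law (X × Y × Z × U × V)) :=
  {P | marg P (fun (x, y, z, _, _) => (x, y, z)) = targetLaw QX W ∧
    MarkovChain P (fun (x, _, _, _, _) => x) (fun (_, _, _, u, v) => (u, v))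
      (fun (_, y, _, _, _) => y) ∧
    MarkovChain P (fun (x, y, _, u, _) => (x, y, u)) (fun (_, _, _, _, v) => v)
      (fun (_, _, z, _, _) => z)}

/-- The rate constraints on `(R₀, R₁, R₂)` determined by a joint distribution of
`(X, Y, Z, U, V)`. -/
def rateSet {U V : Type*} [Fintype U] [Fintype V] (P : Law (X × Y × Z × U × V)) :
    Set (ℝ × ℝ × ℝ) :=
  {R | 0 ≤ R.1 ∧
    mutualInfo P (fun (x, _, _, _, _) => x) (fun (_, _, _, u, v) => (u, v)) ≤ R.2.1 ∧
    mutualInfo P (fun (x, _, _, _, _) => x) (fun (_, _, _, _, v) => v) ≤ R.2.2 ∧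
    mutualInfo P (fun (x, y, z, _, _) => (x, y, z)) (fun (_, _, _, u, v) => (u, v))
      ≤ R.2.1 + R.1 ∧
    mutualInfo P (fun (x, y, z, _, _) => (x, y, z)) (fun (_, _, _, _, v) => v) ≤ R.2.2 + R.1}

/-- The inner bound: the rate triples allowed by some joint distribution in `auxLaws` whose
auxiliary alphabets `𝒰 = Fin a` and `𝒱 = Fin b` satisfy the cardinality bounds
`|𝒱| ≤ |𝒳||𝒴||𝒵| + 3` and `|𝒰| ≤ |𝒳||𝒴||𝒵||𝒱| + 2`. -/
def innerBound (QX : Law X) (W : X → Law (Y × Z)) : Set (ℝ × ℝ × ℝ) :=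
  {R | ∃ a b : ℕ,
    b ≤ Fintype.card X * Fintype.card Y * Fintype.card Z + 3 ∧
    a ≤ Fintype.card X * Fintype.card Y * Fintype.card Z * b + 2 ∧
    ∃ P ∈ auxLaws QX W (Fin a) (Fin b), R ∈ rateSet P}

end Regions

end CascadeSynthesis

end

/-! The inner bound is achieved by a superposition codebook with a likelihood encoder. The two
Markov chains split the joint law as `p(v) q(u|v) κX(x|u,v) κY(y|u,v) κZ(z|v)`
(`exists_channels_of_mem_auxLaws`). Draw i.i.d. clusters, indexed by a message part and the key `k`,
each with a cloud centre `vⁿ` and satellites `uⁿ`. In the ideal law all indices are uniform and the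
codeword passes through the three channels. Node 1 draws the indices from their posterior under this
ideal law given `(xⁿ, k)`. The actual law then differs from the ideal one only in the law of `xⁿ`
given `k`.

Two approximations therefore suffice: the whole codebook must imitate the i.i.d. target through the
joint channel, and each slice of fixed `k` must imitate `Q_X` through `κX`. Both are instances of
`softCovering`, one needing the rates with `R₀` added and the other the rates without it.
`softCovering` combines a truncated second-moment bound (`softCovering_oneShot`) with a Chernoff
bound on the truncated mass (`tendsto_tail`). Averaging over codebooks gives one that is good for
both.

If `X` is independent of `(Y, Z)`, node 2 can draw its message uniformly by itself. Only the
covering of `(Yⁿ, Zⁿ)` by `vⁿ` is then needed, which costs `R₂ + R₀` and nothing on the first link.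
The inner bound cannot exploit this: at `R₀ = R₁ = 0` it forces `I(X,Y,Z;U,V) = 0`, so `V` is
independent of `(Y, Z)`, and `Y - V - Z` makes `Y` and `Z` independent. Taking `V = Y` shows that
`(0, 0, R₂)` is in the region for large `R₂`, which separates the two sets when `Y` and `Z` are
dependent. -/

open Filter Topology

noncomputable section

namespace CascadeSynthesis

/-! ### Finite probability: product laws, variance of empirical means. -/

section FiniteProbability

variable {α ι : Type*} [Fintype α] [Fintype ι] [DecidableEq ι]

theorem law_nonneg (p : Law α) (a : α) : 0 ≤ p a := p.2.1 a

theorem law_sum (p : Law α) : ∑ a, p a = 1 := p.2.2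

/-- A law from its mass function. -/
def mkLaw (f : α → ℝ) (h₀ : ∀ a, 0 ≤ f a) (h₁ : ∑ a, f a = 1) : Law α := ⟨f, h₀, h₁⟩

@[simp] theorem mkLaw_apply (f : α → ℝ) (h₀ : ∀ a, 0 ≤ f a) (h₁ : ∑ a, f a = 1) (a : α) :
    mkLaw f h₀ h₁ a = f a := rfl

theorem sum_prod_pi (f : ι → α → ℝ) : ∑ s : ι → α, ∏ i, f i (s i) = ∏ i, ∑ a, f i a := by
  rw [Finset.prod_univ_sum, Fintype.piFinset_univ]

/-- The law of a family of independent random variables with laws `p i`. -/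
def prodLaw (p : ι → Law α) : Law (ι → α) :=
  mkLaw (fun s => ∏ i, p i (s i)) (fun s => Finset.prod_nonneg fun i _ => law_nonneg _ _)
    (by rw [sum_prod_pi (fun i => p i)]; simp)

/-- The law of an i.i.d. family indexed by `ι`. -/
def iid (ι : Type*) [Fintype ι] [DecidableEq ι] (p : Law α) : Law (ι → α) := prodLaw fun _ => p

@[simp] theorem iid_apply (p : Law α) (s : ι → α) : iid ι p s = ∏ i, p (s i) := rfl

theorem iid_mean (p : Law α) (F : α → ℝ) (j : ι) :
    ∑ s, iid ι p s * F (s j) = ∑ a, p a * F a := by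
  have h : ∀ s : ι → α, iid ι p s * F (s j) =
      ∏ i, (p (s i) * if i = j then F (s i) else 1) := by
    intro s
    rw [Finset.prod_mul_distrib, Finset.prod_ite_eq']
    simp
  simp_rw [h]
  rw [sum_prod_pi (fun i a => p a * if i = j then F a else 1), Finset.prod_eq_single j]
  · simp
  · intro i _ hi
    simp [hi]
  · simp

theorem iid_mean_mul (p : Law α) (F G : α → ℝ) {i j : ι} (hij : i ≠ j) :
    ∑ s, iid ι p s * (F (s i) * G (s j)) = (∑ a, p a * F a) * ∑ a, p a * G a := by
  have h : ∀ s : ι → α, iid ι p s * (F (s i) * G (s j)) =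
      ∏ k, (p (s k) * ((if k = i then F (s k) else 1) * if k = j then G (s k) else 1)) := by
    intro s
    rw [Finset.prod_mul_distrib, Finset.prod_mul_distrib, Finset.prod_ite_eq',
      Finset.prod_ite_eq']
    simp
  simp_rw [h]
  rw [sum_prod_pi (fun k a => p a * ((if k = i then F a else 1) * if k = j then G a else 1)),
    Finset.prod_eq_mul i j hij]
  · simp [hij, hij.symm]
  · intro k _ hk
    simp [hk.1, hk.2]
  · simp
  · simp

/-- The empirical mean of `F` over the coordinates in `S`. -/
def avg (S : Finset ι) (F : ι → ℝ) : ℝ := (S.card : ℝ)⁻¹ * ∑ i ∈ S, F i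

theorem iid_mean_avg (p : Law α) (F : α → ℝ) {S : Finset ι} (hS : S.Nonempty) :
    ∑ s, iid ι p s * avg S (fun i => F (s i)) = ∑ a, p a * F a := by
  have h : ∀ s : ι → α, iid ι p s * avg S (fun i => F (s i)) =
      (S.card : ℝ)⁻¹ * ∑ i ∈ S, iid ι p s * F (s i) := by
    intro s
    rw [avg, Finset.mul_sum, Finset.mul_sum, Finset.mul_sum]
    exact Finset.sum_congr rfl fun i _ => by ring
  simp_rw [h]
  rw [← Finset.mul_sum, Finset.sum_comm]
  simp_rw [iid_mean]
  have : (S.card : ℝ) ≠ 0 := by exact_mod_cast hS.card_pos.ne'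
  simp [this]

/-- After centring, the cross terms of the squared sum vanish by independence; only the `S.card`
diagonal terms remain. -/
theorem iid_variance (p : Law α) (F : α → ℝ) {S : Finset ι} (hS : S.Nonempty) :
    ∑ s, iid ι p s * (avg S (fun i => F (s i)) - ∑ a, p a * F a) ^ 2 =
      (S.card : ℝ)⁻¹ * (∑ a, p a * F a ^ 2 - (∑ a, p a * F a) ^ 2) := by
  set m := ∑ a, p a * F a with hm
  have hc : (S.card : ℝ) ≠ 0 := by exact_mod_cast hS.card_pos.ne'
  have h0 : ∑ a, p a * (F a - m) = 0 := by
    simp_rw [mul_sub]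
    rw [Finset.sum_sub_distrib, ← Finset.sum_mul, law_sum, ← hm]
    ring
  have h2 : ∑ a, p a * ((F a - m) * (F a - m)) = ∑ a, p a * F a ^ 2 - m ^ 2 := by
    have : ∀ a, p a * ((F a - m) * (F a - m)) =
        p a * F a ^ 2 - 2 * m * (p a * F a) + m ^ 2 * p a := fun a => by ring
    simp_rw [this]
    rw [Finset.sum_add_distrib, Finset.sum_sub_distrib, ← Finset.mul_sum, ← Finset.mul_sum,
      law_sum, ← hm]
    ring
  have h : ∀ s : ι → α, iid ι p s * (avg S (fun i => F (s i)) - m) ^ 2 =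
      ((S.card : ℝ)⁻¹) ^ 2 *
        ∑ i ∈ S, ∑ j ∈ S, iid ι p s * ((F (s i) - m) * (F (s j) - m)) := by
    intro s
    have : avg S (fun i => F (s i)) - m = (S.card : ℝ)⁻¹ * ∑ i ∈ S, (F (s i) - m) := by
      rw [avg, Finset.sum_sub_distrib]
      simp only [Finset.sum_const, nsmul_eq_mul]
      field_simp
    rw [this, mul_pow, sq (∑ i ∈ S, _), Finset.sum_mul_sum]
    simp_rw [Finset.mul_sum]
    refine Finset.sum_congr rfl fun i _ => Finset.sum_congr rfl fun j _ => by ring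
  simp_rw [h]
  rw [← Finset.mul_sum, Finset.sum_comm]
  have h3 : ∀ i ∈ S, ∑ s : ι → α, ∑ j ∈ S, iid ι p s * ((F (s i) - m) * (F (s j) - m)) =
      ∑ a, p a * F a ^ 2 - m ^ 2 := by
    intro i hi
    rw [Finset.sum_comm, Finset.sum_eq_single_of_mem i hi]
    · rw [iid_mean p (fun a => (F a - m) * (F a - m)) i, h2]
    · intro j _ hj
      rw [iid_mean_mul p (fun a => F a - m) (fun a => F a - m) hj.symm, h0, zero_mul]
  rw [Finset.sum_congr rfl h3]
  simp only [Finset.sum_const, nsmul_eq_mul]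
  field_simp

theorem mean_abs_le_sqrt (p : Law α) (F : α → ℝ) :
    ∑ a, p a * |F a| ≤ √(∑ a, p a * F a ^ 2) := by
  apply Real.le_sqrt_of_sq_le
  have := Finset.sum_sq_le_sum_mul_sum_of_sq_le_mul (Finset.univ : Finset α)
    (r := fun a => p a * |F a|) (f := fun a => p a) (g := fun a => p a * F a ^ 2)
    (fun a _ => law_nonneg p a) (fun a _ => mul_nonneg (law_nonneg p a) (sq_nonneg _))
    (fun a _ => by rw [mul_pow, sq_abs]; exact le_of_eq (by ring))
  simpa [law_sum] using this

/-- Derandomization: extracts a good codebook from a bound on the average over random codebooks. -/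
theorem exists_le_of_mean_le (p : Law α) (F : α → ℝ) {B : ℝ} (h : ∑ a, p a * F a ≤ B) :
    ∃ a, F a ≤ B := by
  by_contra! hB
  have h1 : ∑ a, p a * B ≤ ∑ a, p a * F a :=
    Finset.sum_le_sum fun a _ => mul_le_mul_of_nonneg_left (hB a).le (law_nonneg p a)
  rw [← Finset.sum_mul, law_sum, one_mul] at h1
  obtain ⟨a, -, ha⟩ : ∃ a ∈ Finset.univ, p a ≠ 0 := by
    apply Finset.exists_ne_zero_of_sum_ne_zero
    rw [law_sum]
    exact one_ne_zero
  have h2 : ∑ a, p a * B < ∑ a, p a * F a :=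
    Finset.sum_lt_sum (fun a _ => mul_le_mul_of_nonneg_left (hB a).le (law_nonneg p a))
      ⟨a, Finset.mem_univ _,
        mul_lt_mul_of_pos_left (hB a) (lt_of_le_of_ne (law_nonneg p a) (Ne.symm ha))⟩
  rw [← Finset.sum_mul, law_sum, one_mul] at h2
  linarith

theorem avg_add (S : Finset ι) (F G : ι → ℝ) :
    avg S (fun i => F i + G i) = avg S F + avg S G := by
  simp [avg, Finset.sum_add_distrib, mul_add]

theorem avg_nonneg {S : Finset ι} {F : ι → ℝ} (h : ∀ i, 0 ≤ F i) : 0 ≤ avg S F :=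
  mul_nonneg (by positivity) (Finset.sum_nonneg fun i _ => h i)

end FiniteProbability

/-! ### One-shot soft covering for superposition codebooks. -/

section SoftCovering

variable {ι A V U S : Type*} [Fintype ι] [Fintype A] [Fintype V] [Fintype U] [Fintype S]
  [DecidableEq ι] [DecidableEq A]

/-- The law of a cluster of a superposition codebook: a cloud centre of law `p`, and satellites
that are conditionally i.i.d. given the centre. -/
def cluster (A : Type*) [Fintype A] [DecidableEq A] (p : Law V) (q : V → Law U) : Law (V × (A → U)) :=
  mkLaw (fun c => p c.1 * iid A (q c.1) c.2)
    (fun c => mul_nonneg (law_nonneg p _) (law_nonneg _ _))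
    (by
      rw [Fintype.sum_prod_type]
      simp_rw [← Finset.mul_sum, law_sum, mul_one, law_sum])

theorem cluster_apply (p : Law V) (q : V → Law U) (c : V × (A → U)) :
    cluster A p q c = p c.1 * iid A (q c.1) c.2 := rfl

/-- The mean of `f` over the satellites of a cluster. -/
def clusterAvg (f : V → U → ℝ) (c : V × (A → U)) : ℝ := avg Finset.univ fun a => f c.1 (c.2 a)

/-- The expectation of `f` under the law with marginal `p` and conditionals `q`. -/
def mean₂ (p : Law V) (q : V → Law U) (f : V → U → ℝ) : ℝ := ∑ v, p v * ∑ u, q v u * f v u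

theorem mean₂_nonneg (p : Law V) (q : V → Law U) {f : V → U → ℝ} (h : ∀ v u, 0 ≤ f v u) :
    0 ≤ mean₂ p q f :=
  Finset.sum_nonneg fun v _ => mul_nonneg (law_nonneg p v)
    (Finset.sum_nonneg fun u _ => mul_nonneg (law_nonneg _ u) (h v u))

theorem mean₂_mono (p : Law V) (q : V → Law U) {f g : V → U → ℝ} (h : ∀ v u, f v u ≤ g v u) :
    mean₂ p q f ≤ mean₂ p q g :=
  Finset.sum_le_sum fun v _ => mul_le_mul_of_nonneg_left
    (Finset.sum_le_sum fun u _ => mul_le_mul_of_nonneg_left (h v u) (law_nonneg _ u))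
    (law_nonneg p v)

theorem mean₂_mul_const (p : Law V) (q : V → Law U) (f : V → U → ℝ) (c : ℝ) :
    mean₂ p q (fun v u => f v u * c) = mean₂ p q f * c := by
  simp only [mean₂]
  rw [Finset.sum_mul]
  refine Finset.sum_congr rfl fun v _ => ?_
  rw [mul_assoc, Finset.sum_mul]
  congr 1
  exact Finset.sum_congr rfl fun u _ => by ring

theorem mean₂_add (p : Law V) (q : V → Law U) (f g : V → U → ℝ) :
    mean₂ p q (fun v u => f v u + g v u) = mean₂ p q f + mean₂ p q g := by
  simp only [mean₂, mul_add, Finset.sum_add_distrib]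

theorem mean₂_sum (p : Law V) (q : V → Law U) (f : S → V → U → ℝ) :
    mean₂ p q (fun v u => ∑ w, f w v u) = ∑ w, mean₂ p q (f w) := by
  simp only [mean₂]
  rw [Finset.sum_comm]
  refine Finset.sum_congr rfl fun v _ => ?_
  rw [← Finset.mul_sum, Finset.sum_comm]
  simp_rw [Finset.mul_sum]

theorem cluster_mean [Nonempty A] (p : Law V) (q : V → Law U) (f : V → U → ℝ) :
    ∑ c : V × (A → U), cluster A p q c * clusterAvg f c = mean₂ p q f := by
  rw [Fintype.sum_prod_type, mean₂]
  refine Finset.sum_congr rfl fun v _ => ?_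
  rw [← iid_mean_avg (ι := A) (q v) (f v) Finset.univ_nonempty, Finset.mul_sum]
  exact Finset.sum_congr rfl fun s _ => by rw [cluster_apply, clusterAvg, mul_assoc]

/-- Conditionally on the centre, the second moment is the variance of an i.i.d. mean, reduced by the
factor `1 / |A|`, plus the squared conditional mean. The satellites do not reduce the latter; this
is why the centres need a rate condition of their own. -/
theorem cluster_second_moment_le [Nonempty A] (p : Law V) (q : V → Law U) (f : V → U → ℝ) :
    ∑ c : V × (A → U), cluster A p q c * clusterAvg f c ^ 2 ≤
      (Fintype.card A : ℝ)⁻¹ * mean₂ p q (fun v u => f v u ^ 2) +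
        ∑ v, p v * (∑ u, q v u * f v u) ^ 2 := by
  rw [Fintype.sum_prod_type, mean₂, Finset.mul_sum, ← Finset.sum_add_distrib]
  refine Finset.sum_le_sum fun v _ => ?_
  have hvar := iid_variance (ι := A) (q v) (f v) Finset.univ_nonempty
  have hmean := iid_mean_avg (ι := A) (q v) (f v) Finset.univ_nonempty
  set m := ∑ u, q v u * f v u
  have h1 : ∑ s : A → U, iid A (q v) s * (avg Finset.univ (fun i => f v (s i)) - m) ^ 2 =
      ∑ s : A → U, iid A (q v) s * avg Finset.univ (fun i => f v (s i)) ^ 2 - m ^ 2 := by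
    have : ∀ s : A → U, iid A (q v) s * (avg Finset.univ (fun i => f v (s i)) - m) ^ 2 =
        iid A (q v) s * avg Finset.univ (fun i => f v (s i)) ^ 2 -
        2 * m * (iid A (q v) s * avg Finset.univ (fun i => f v (s i))) +
        m ^ 2 * iid A (q v) s := fun s => by ring
    simp_rw [this]
    rw [Finset.sum_add_distrib, Finset.sum_sub_distrib, ← Finset.mul_sum, ← Finset.mul_sum,
      law_sum, hmean]
    ring
  rw [h1, Finset.card_univ] at hvar
  have h2 : ∑ s : A → U, cluster A p q (v, s) * clusterAvg f (v, s) ^ 2 =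
      p v * ∑ s : A → U, iid A (q v) s * avg Finset.univ (fun i => f v (s i)) ^ 2 := by
    rw [Finset.mul_sum]
    exact Finset.sum_congr rfl fun s _ => by rw [cluster_apply, clusterAvg, mul_assoc]
  have h3 : ∑ s : A → U, iid A (q v) s * avg Finset.univ (fun i => f v (s i)) ^ 2 ≤
      (Fintype.card A : ℝ)⁻¹ * ∑ u, q v u * f v u ^ 2 + m ^ 2 := by
    have : 0 ≤ (Fintype.card A : ℝ)⁻¹ * m ^ 2 := by positivity
    linarith
  rw [h2]
  calc _ ≤ p v * ((Fintype.card A : ℝ)⁻¹ * ∑ u, q v u * f v u ^ 2 + m ^ 2) :=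
        mul_le_mul_of_nonneg_left h3 (law_nonneg p v)
    _ = _ := by ring

/-- The law at the output of the channel `κ` with input law `(p, q)`. -/
def outLaw (p : Law V) (q : V → Law U) (κ : V → U → Law S) (w : S) : ℝ :=
  mean₂ p q fun v u => κ v u w

/-- The channel from the cloud centre to the output. -/
def centreChannel (q : V → Law U) (κ : V → U → Law S) (v : V) (w : S) : ℝ :=
  ∑ u, q v u * κ v u w

/-- The output law induced by the part `T` of a superposition codebook. -/
def codebookLaw (κ : V → U → Law S) (T : Finset ι) (cb : ι → V × (A → U)) (w : S) : ℝ :=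
  avg T fun i => clusterAvg (fun v u => κ v u w) (cb i)

/-- The triples whose likelihood ratios exceed the thresholds `a₁` or `a₂`. -/
def Atypical (p : Law V) (q : V → Law U) (κ : V → U → Law S) (a₁ a₂ : ℝ)
    (v : V) (u : U) (w : S) : Prop :=
  a₁ * outLaw p q κ w < κ v u w ∨ a₂ * outLaw p q κ w < centreChannel q κ v w

open Classical in
/-- One-shot soft covering for superposition codes. -/
theorem softCovering_oneShot [Nonempty A] (p : Law V) (q : V → Law U) (κ : V → U → Law S)
    {a₁ a₂ : ℝ} (ha₁ : 0 ≤ a₁) (ha₂ : 0 ≤ a₂) {T : Finset ι} (hT : T.Nonempty) :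
    ∑ cb, iid ι (cluster A p q) cb * ∑ w, |codebookLaw κ T cb w - outLaw p q κ w| ≤
      √(a₁ / (T.card * Fintype.card A) + a₂ / T.card) +
        2 * ∑ w, mean₂ p q fun v u => if Atypical p q κ a₁ a₂ v u w then κ v u w else 0 := by
  set B := a₁ / (T.card * Fintype.card A) + a₂ / T.card with hB
  have hT0 : (0 : ℝ) < T.card := by exact_mod_cast hT.card_pos
  have hA0 : (0 : ℝ) < Fintype.card A := by exact_mod_cast Fintype.card_pos
  -- Truncation: the typical part `f` has bounded likelihood ratios, hence a small variance; the
  -- atypical part `g` is controlled only through its mean.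
  set f : S → V → U → ℝ := fun w v u => if Atypical p q κ a₁ a₂ v u w then 0 else κ v u w with hf
  set g : S → V → U → ℝ := fun w v u => if Atypical p q κ a₁ a₂ v u w then κ v u w else 0 with hg
  have hP : ∀ w, 0 ≤ outLaw p q κ w := fun w => mean₂_nonneg p q fun v u => law_nonneg _ _
  have hfg : ∀ w, (fun v u => κ v u w) = fun v u => f w v u + g w v u := by
    intro w; funext v u; simp only [hf, hg]; split_ifs <;> simp
  have hf0 : ∀ w v u, 0 ≤ f w v u := by
    intro w v u; simp only [hf]; split_ifs; exacts [le_rfl, law_nonneg _ _]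
  have hg0 : ∀ w v u, 0 ≤ g w v u := by
    intro w v u; simp only [hg]; split_ifs; exacts [law_nonneg _ _, le_rfl]
  have hfκ : ∀ w v u, f w v u ≤ κ v u w := by
    intro w v u; simp only [hf]; split_ifs; exacts [law_nonneg _ _, le_rfl]
  have hf1 : ∀ w v u, f w v u ≤ a₁ * outLaw p q κ w := by
    intro w v u; simp only [hf]; split_ifs with h
    · exact mul_nonneg ha₁ (hP w)
    · exact not_lt.1 fun h' => h (Or.inl h')
  have hf2 : ∀ w v, ∑ u, q v u * f w v u ≤ a₂ * outLaw p q κ w := by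
    intro w v
    -- This second atypicality condition does not involve `u`, so when it holds all terms of the sum
    -- vanish at once.
    by_cases h : a₂ * outLaw p q κ w < centreChannel q κ v w
    · have : ∀ u, f w v u = 0 := fun u => if_pos (Or.inr h)
      simp only [this, mul_zero, Finset.sum_const_zero]
      exact mul_nonneg ha₂ (hP w)
    · refine le_trans (Finset.sum_le_sum fun u _ => ?_) (not_lt.1 h)
      exact mul_le_mul_of_nonneg_left (hfκ w v u) (law_nonneg _ _)
  have hfm : ∀ w, mean₂ p q (f w) ≤ outLaw p q κ w := fun w => mean₂_mono p q (hfκ w)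
  -- The bound scales with `outLaw ^ 2`, so the standard deviations are `outLaw * √B` and sum over
  -- `w` to `√B`, whatever the output alphabet.
  have hvar : ∀ w, ∑ cb, iid ι (cluster A p q) cb *
      (avg T (fun i => clusterAvg (f w) (cb i)) - mean₂ p q (f w)) ^ 2 ≤
        outLaw p q κ w ^ 2 * B := by
    intro w
    have h := iid_variance (cluster A p q) (clusterAvg (f w)) hT
    rw [cluster_mean] at h
    rw [h]
    have h1 : mean₂ p q (fun v u => f w v u ^ 2) ≤ outLaw p q κ w * (a₁ * outLaw p q κ w) := by
      refine (mean₂_mono p q (g := fun v u => f w v u * (a₁ * outLaw p q κ w))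
        fun v u => ?_).trans ?_
      · rw [sq]; exact mul_le_mul_of_nonneg_left (hf1 w v u) (hf0 w v u)
      · rw [mean₂_mul_const]
        exact mul_le_mul_of_nonneg_right (hfm w) (mul_nonneg ha₁ (hP w))
    have h2 : ∑ v, p v * (∑ u, q v u * f w v u) ^ 2 ≤
        outLaw p q κ w * (a₂ * outLaw p q κ w) := by
      refine (Finset.sum_le_sum (g := fun v => p v * (∑ u, q v u * f w v u) *
        (a₂ * outLaw p q κ w)) fun v _ => ?_).trans ?_
      · rw [sq, mul_assoc]
        refine mul_le_mul_of_nonneg_left (mul_le_mul_of_nonneg_left (hf2 w v) ?_) (law_nonneg p v)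
        exact Finset.sum_nonneg fun u _ => mul_nonneg (law_nonneg _ _) (hf0 w v u)
      · rw [← Finset.sum_mul]
        exact mul_le_mul_of_nonneg_right (hfm w) (mul_nonneg ha₂ (hP w))
    have h3 := cluster_second_moment_le (A := A) p q (f w)
    calc _ ≤ (T.card : ℝ)⁻¹ * ((Fintype.card A : ℝ)⁻¹ *
          (outLaw p q κ w * (a₁ * outLaw p q κ w)) + outLaw p q κ w * (a₂ * outLaw p q κ w)) := by
          refine mul_le_mul_of_nonneg_left ?_ (by positivity)
          have h4 := mul_le_mul_of_nonneg_left h1 (inv_nonneg.2 hA0.le)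
          nlinarith [sq_nonneg (mean₂ p q (f w))]
      _ = _ := by rw [hB]; field_simp
  have habs : ∀ w, ∑ cb, iid ι (cluster A p q) cb *
      |avg T (fun i => clusterAvg (f w) (cb i)) - mean₂ p q (f w)| ≤ outLaw p q κ w * √B := by
    intro w
    refine (mean_abs_le_sqrt _ _).trans ((Real.sqrt_le_sqrt (hvar w)).trans_eq ?_)
    rw [Real.sqrt_mul (sq_nonneg _), Real.sqrt_sq (hP w)]
  have hsplit : ∀ cb w, |codebookLaw κ T cb w - outLaw p q κ w| ≤
      |avg T (fun i => clusterAvg (f w) (cb i)) - mean₂ p q (f w)| +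
        avg T (fun i => clusterAvg (A := A) (g w) (cb i)) + mean₂ p q (g w) := by
    intro cb w
    have h1 : codebookLaw κ T cb w =
        avg T (fun i => clusterAvg (f w) (cb i)) + avg T (fun i => clusterAvg (g w) (cb i)) := by
      rw [codebookLaw, hfg w, ← avg_add]
      simp only [clusterAvg, avg_add]
    have h2 : outLaw p q κ w = mean₂ p q (f w) + mean₂ p q (g w) := by
      rw [outLaw, hfg w, mean₂_add]
    have h3 : 0 ≤ avg T (fun i => clusterAvg (A := A) (g w) (cb i)) :=
      avg_nonneg fun i => avg_nonneg fun a => hg0 _ _ _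
    have h4 := mean₂_nonneg p q (hg0 w)
    rw [h1, h2]
    calc _ = |(avg T (fun i => clusterAvg (f w) (cb i)) - mean₂ p q (f w)) +
          (avg T (fun i => clusterAvg (A := A) (g w) (cb i)) - mean₂ p q (g w))| := by
            congr 1; ring
      _ ≤ _ := by
        refine (abs_add_le _ _).trans ?_
        rw [add_assoc]
        gcongr
        -- Both atypical terms are nonnegative, so their difference is at most their sum; averaging
        -- over codebooks makes this twice the mean of `g`.
        exact abs_le.2 ⟨by linarith, by linarith⟩
  have hPsum : ∑ w, outLaw p q κ w = 1 := by
    simp only [outLaw]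
    rw [← mean₂_sum p q (fun w v u => κ v u w)]
    simp [mean₂]
  calc _ ≤ ∑ cb, ∑ w, iid ι (cluster A p q) cb *
        (|avg T (fun i => clusterAvg (f w) (cb i)) - mean₂ p q (f w)| +
          avg T (fun i => clusterAvg (A := A) (g w) (cb i)) + mean₂ p q (g w)) := by
        refine Finset.sum_le_sum fun cb _ => ?_
        rw [Finset.mul_sum]
        exact Finset.sum_le_sum fun w _ =>
          mul_le_mul_of_nonneg_left (hsplit cb w) (law_nonneg _ _)
    _ = ∑ w, (∑ cb, iid ι (cluster A p q) cb *
          |avg T (fun i => clusterAvg (f w) (cb i)) - mean₂ p q (f w)| +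
            2 * mean₂ p q (g w)) := by
        rw [Finset.sum_comm]
        refine Finset.sum_congr rfl fun w _ => ?_
        simp_rw [mul_add, Finset.sum_add_distrib]
        rw [iid_mean_avg (cluster A p q) (clusterAvg (g w)) hT, cluster_mean, ← Finset.sum_mul,
          law_sum]
        ring
    _ ≤ ∑ w, (outLaw p q κ w * √B + 2 * mean₂ p q (g w)) :=
        Finset.sum_le_sum fun w _ => by have := habs w; linarith
    _ = _ := by
        rw [Finset.sum_add_distrib, ← Finset.sum_mul, hPsum, one_mul, Finset.mul_sum]

end SoftCovering

/-! ### Exponential moments. -/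

section Chernoff

variable {α : Type*} [Fintype α]

/-- The exponential moment is `1` at `l = 0` and its derivative there is the mean of `g - c`, which
is negative; so it drops below `1` just to the right of `0`. -/
theorem exists_exp_moment_lt_one (p : Law α) (g : α → ℝ) {c : ℝ} (hc : ∑ a, p a * g a < c) :
    ∃ l > 0, ∑ a, p a * Real.exp (l * (g a - c)) < 1 := by
  set h : ℝ → ℝ := fun l => ∑ a, p a * Real.exp (l * (g a - c)) with hh
  have h0 : h 0 = 1 := by simp [hh]
  have hd : HasDerivAt h (∑ a, p a * (g a - c)) 0 := by
    apply HasDerivAt.fun_sum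
    intro a _
    have := (((hasDerivAt_id (0 : ℝ)).mul_const (g a - c)).exp).const_mul (p a)
    simpa using this
  have hneg : ∑ a, p a * (g a - c) < 0 := by
    simp_rw [mul_sub]
    rw [Finset.sum_sub_distrib, ← Finset.sum_mul, law_sum]
    linarith
  have hslope := (hasDerivAt_iff_tendsto_slope.1 hd).mono_left (nhdsGT_le_nhdsNE 0)
  have hev : ∀ᶠ l in 𝓝[>] (0 : ℝ), slope h 0 l < 0 :=
    hslope.eventually (gt_mem_nhds hneg)
  obtain ⟨l, hl, hl0⟩ := (hev.and self_mem_nhdsWithin).exists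
  refine ⟨l, hl0, ?_⟩
  have hl0' : (0 : ℝ) < l := hl0
  rw [slope_def_field, sub_zero, div_neg_iff] at hl
  have : h l < 1 := by
    rcases hl with hl | hl
    · linarith [hl.2]
    · linarith [hl.1]
  exact this

end Chernoff

/-! ### Memoryless extensions and asymptotic soft covering. -/

section Blocks

variable {V U S : Type*} [Fintype V] [Fintype U] [Fintype S]

/-- The memoryless extension of `q`. -/
def ext₁ (n : ℕ) (q : V → Law U) (v : Fin n → V) : Law (Fin n → U) := prodLaw fun t => q (v t)

/-- The memoryless extension of `κ`. -/
def ext₂ (n : ℕ) (κ : V → U → Law S) (v : Fin n → V) (u : Fin n → U) : Law (Fin n → S) :=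
  prodLaw fun t => κ (v t) (u t)

@[simp] theorem ext₁_apply (n : ℕ) (q : V → Law U) (v : Fin n → V) (u : Fin n → U) :
    ext₁ n q v u = ∏ t, q (v t) (u t) := rfl

@[simp] theorem ext₂_apply (n : ℕ) (κ : V → U → Law S) (v : Fin n → V) (u : Fin n → U)
    (w : Fin n → S) : ext₂ n κ v u w = ∏ t, κ (v t) (u t) (w t) := rfl

/-- Likelihood ratios are positive only on the support, so comparisons of logarithms are needed, and
made, only there. -/
theorem mean₂_mono_of_support (p : Law V) (q : V → Law U) {f g : V → U → ℝ}
    (h : ∀ v u, p v ≠ 0 → q v u ≠ 0 → f v u ≤ g v u) : mean₂ p q f ≤ mean₂ p q g := by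
  refine Finset.sum_le_sum fun v _ => ?_
  by_cases hv : p v = 0
  · simp [hv]
  refine mul_le_mul_of_nonneg_left (Finset.sum_le_sum fun u _ => ?_) (law_nonneg p v)
  by_cases hu : q v u = 0
  · simp [hu]
  exact mul_le_mul_of_nonneg_left (h v u hv hu) (law_nonneg _ u)

theorem le_mean₂ (p : Law V) (q : V → Law U) {f : V → U → ℝ} (h : ∀ v u, 0 ≤ f v u)
    (v : V) (u : U) : p v * (q v u * f v u) ≤ mean₂ p q f := by
  have h1 : ∀ v u, 0 ≤ q v u * f v u := fun v u => mul_nonneg (law_nonneg _ _) (h v u)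
  refine le_trans (mul_le_mul_of_nonneg_left ?_ (law_nonneg p v))
    (Finset.single_le_sum (f := fun v => p v * ∑ u, q v u * f v u)
      (fun v _ => mul_nonneg (law_nonneg p v) (Finset.sum_nonneg fun u _ => h1 v u))
      (Finset.mem_univ v))
  exact Finset.single_le_sum (f := fun u => q v u * f v u) (fun u _ => h1 v u) (Finset.mem_univ u)

theorem mean₂_prod {n : ℕ} (p : Law V) (q : V → Law U) (f : Fin n → V → U → ℝ) :
    mean₂ (iid (Fin n) p) (ext₁ n q) (fun v u => ∏ t, f t (v t) (u t)) =
      ∏ t, mean₂ p q (f t) := by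
  simp only [mean₂, iid_apply, ext₁_apply, ← Finset.prod_mul_distrib]
  have : ∀ v : Fin n → V, ∑ u : Fin n → U, ∏ t, (q (v t) (u t) * f t (v t) (u t)) =
      ∏ t, ∑ u, q (v t) u * f t (v t) u := fun v =>
    sum_prod_pi (fun t u => q (v t) u * f t (v t) u)
  simp_rw [this, ← Finset.prod_mul_distrib]
  exact sum_prod_pi (fun t v => p v * ∑ u, q v u * f t v u)

theorem outLaw_ext {n : ℕ} (p : Law V) (q : V → Law U) (κ : V → U → Law S) (w : Fin n → S) :
    outLaw (iid (Fin n) p) (ext₁ n q) (ext₂ n κ) w = ∏ t, outLaw p q κ (w t) :=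
  mean₂_prod p q fun t v u => κ v u (w t)

theorem centreChannel_ext {n : ℕ} (q : V → Law U) (κ : V → U → Law S) (v : Fin n → V)
    (w : Fin n → S) :
    centreChannel (ext₁ n q) (ext₂ n κ) v w = ∏ t, centreChannel q κ (v t) (w t) := by
  simp only [centreChannel, ext₁_apply, ext₂_apply, ← Finset.prod_mul_distrib]
  exact sum_prod_pi (fun t u => q (v t) u * κ (v t) u (w t))

/-- The expectation of `f` under the joint law of input and output of `κ`. -/
def mean₃ (p : Law V) (q : V → Law U) (κ : V → U → Law S) (f : V → U → S → ℝ) : ℝ :=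
  ∑ w, mean₂ p q fun v u => κ v u w * f v u w

theorem mean₃_prod {n : ℕ} (p : Law V) (q : V → Law U) (κ : V → U → Law S) (f : V → U → S → ℝ) :
    mean₃ (iid (Fin n) p) (ext₁ n q) (ext₂ n κ) (fun v u w => ∏ t, f (v t) (u t) (w t)) =
      mean₃ p q κ f ^ n := by
  simp only [mean₃, ext₂_apply, ← Finset.prod_mul_distrib]
  have : ∀ w : Fin n → S, mean₂ (iid (Fin n) p) (ext₁ n q)
      (fun v u => ∏ t, (κ (v t) (u t) (w t) * f (v t) (u t) (w t))) =
      ∏ t, mean₂ p q (fun v u => κ v u (w t) * f v u (w t)) := fun w =>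
    mean₂_prod p q (fun t v u => κ v u (w t) * f v u (w t))
  simp_rw [this]
  rw [sum_prod_pi (fun (_ : Fin n) w => mean₂ p q (fun v u => κ v u w * f v u w))]
  simp

/-- The joint law of the inputs and the output of `κ`. -/
def jointLaw (p : Law V) (q : V → Law U) (κ : V → U → Law S) : Law (S × V × U) :=
  mkLaw (fun a => p a.2.1 * (q a.2.1 a.2.2 * κ a.2.1 a.2.2 a.1))
    (fun a => mul_nonneg (law_nonneg _ _) (mul_nonneg (law_nonneg _ _) (law_nonneg _ _)))
    (by
      rw [Fintype.sum_prod_type, Finset.sum_comm, Fintype.sum_prod_type]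
      simp_rw [← Finset.mul_sum]
      simp)

theorem mean₃_eq_sum (p : Law V) (q : V → Law U) (κ : V → U → Law S) (f : V → U → S → ℝ) :
    mean₃ p q κ f = ∑ a, jointLaw p q κ a * f a.2.1 a.2.2 a.1 := by
  rw [Fintype.sum_prod_type]
  refine Finset.sum_congr rfl fun w _ => ?_
  rw [Fintype.sum_prod_type]
  refine Finset.sum_congr rfl fun v _ => ?_
  rw [Finset.mul_sum]
  exact Finset.sum_congr rfl fun u _ => by simp only [jointLaw, mkLaw_apply]; ring

theorem mean₃_mono_of_support (p : Law V) (q : V → Law U) (κ : V → U → Law S)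
    {f g : V → U → S → ℝ} (h : ∀ v u w, p v ≠ 0 → q v u ≠ 0 → κ v u w ≠ 0 → f v u w ≤ g v u w) :
    mean₃ p q κ f ≤ mean₃ p q κ g := by
  refine Finset.sum_le_sum fun w _ => mean₂_mono_of_support p q fun v u hv hu => ?_
  by_cases hw : κ v u w = 0
  · simp [hw]
  exact mul_le_mul_of_nonneg_left (h v u w hv hu hw) (law_nonneg _ w)

theorem mean₃_nonneg (p : Law V) (q : V → Law U) (κ : V → U → Law S)
    {f : V → U → S → ℝ} (h : ∀ v u w, 0 ≤ f v u w) : 0 ≤ mean₃ p q κ f :=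
  Finset.sum_nonneg fun w _ => mean₂_nonneg p q fun v u => mul_nonneg (law_nonneg _ _) (h v u w)

open Classical in
/-- The probability that the likelihood ratio of the block exceeds `2 ^ (n c)`. -/
def tail (p : Law V) (q : V → Law U) (κ : V → U → Law S) (a : V → U → S → ℝ) (b : S → ℝ)
    (c : ℝ) (n : ℕ) : ℝ :=
  mean₃ (iid (Fin n) p) (ext₁ n q) (ext₂ n κ) fun v u w =>
    if (2 : ℝ) ^ ((n : ℝ) * c) * ∏ t, b (w t) < ∏ t, a (v t) (u t) (w t) then 1 else 0

/-- Chernoff bound: the indicator of the event is at most `∏ exp (l * (log-ratio - c))`, whose mean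
is the `n`-th power of a number below `1`. -/
theorem tendsto_tail (p : Law V) (q : V → Law U) (κ : V → U → Law S) (a : V → U → S → ℝ)
    (b : S → ℝ) {c : ℝ}
    (hpos : ∀ v u w, p v ≠ 0 → q v u ≠ 0 → κ v u w ≠ 0 → 0 < a v u w ∧ 0 < b w)
    (hc : mean₃ p q κ (fun v u w => Real.logb 2 (a v u w / b w)) < c) :
    Tendsto (tail p q κ a b c) atTop (𝓝 0) := by
  rw [mean₃_eq_sum] at hc
  obtain ⟨l, hl, hlt⟩ := exists_exp_moment_lt_one _ _ hc
  rw [← mean₃_eq_sum p q κ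
    (fun v u w => Real.exp (l * (Real.logb 2 (a v u w / b w) - c)))] at hlt
  refine squeeze_zero (fun n => mean₃_nonneg _ _ _ fun v u w => by split_ifs <;> norm_num)
    (fun n => ?_) (tendsto_pow_atTop_nhds_zero_of_lt_one
      (mean₃_nonneg p q κ fun v u w => (Real.exp_pos _).le) hlt)
  rw [← mean₃_prod]
  refine mean₃_mono_of_support _ _ _ fun v u w hv hu hw => ?_
  simp only [iid_apply, ext₁_apply, ext₂_apply, Finset.prod_ne_zero_iff, Finset.mem_univ,
    true_imp_iff] at hv hu hw
  have ha : ∀ t, 0 < a (v t) (u t) (w t) := fun t => (hpos _ _ _ (hv t) (hu t) (hw t)).1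
  have hb : ∀ t, 0 < b (w t) := fun t => (hpos _ _ _ (hv t) (hu t) (hw t)).2
  rw [← Real.exp_sum]
  split_ifs with h
  · rw [Real.one_le_exp_iff, ← Finset.mul_sum]
    refine mul_nonneg hl.le ?_
    rw [Finset.sum_sub_distrib, sub_nonneg, ← Real.logb_prod _ _ fun t _ =>
      (div_pos (ha t) (hb t)).ne', Finset.prod_div_distrib]
    have hB : 0 < ∏ t, b (w t) := Finset.prod_pos fun t _ => hb t
    rw [← lt_div_iff₀ hB] at h
    simp only [Finset.sum_const, Finset.card_univ, Fintype.card_fin, nsmul_eq_mul]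
    rw [Real.le_logb_iff_rpow_le one_lt_two ((by positivity : (0 : ℝ) < _).trans h)]
    exact h.le
  · exact (Real.exp_pos _).le

/-- The mutual information between both inputs and the output of `κ`. -/
def info₁ (p : Law V) (q : V → Law U) (κ : V → U → Law S) : ℝ :=
  mean₃ p q κ fun v u w => Real.logb 2 (κ v u w / outLaw p q κ w)

/-- The mutual information between the cloud centre and the output of `κ`. -/
def info₂ (p : Law V) (q : V → Law U) (κ : V → U → Law S) : ℝ :=
  mean₃ p q κ fun v _ w => Real.logb 2 (centreChannel q κ v w / outLaw p q κ w)

theorem outLaw_pos (p : Law V) (q : V → Law U) (κ : V → U → Law S) {v : V} {u : U} {w : S}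
    (hv : p v ≠ 0) (hu : q v u ≠ 0) (hw : κ v u w ≠ 0) : 0 < outLaw p q κ w := by
  refine lt_of_lt_of_le ?_ (le_mean₂ p q (fun v u => law_nonneg (κ v u) w) v u)
  exact mul_pos ((law_nonneg _ _).lt_of_ne' hv)
    (mul_pos ((law_nonneg _ _).lt_of_ne' hu) ((law_nonneg _ _).lt_of_ne' hw))

theorem centreChannel_pos (q : V → Law U) (κ : V → U → Law S) {v : V} {u : U} {w : S}
    (hu : q v u ≠ 0) (hw : κ v u w ≠ 0) : 0 < centreChannel q κ v w := by
  refine lt_of_lt_of_le ?_ (Finset.single_le_sum (f := fun u => q v u * κ v u w)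
    (fun u _ => mul_nonneg (law_nonneg _ _) (law_nonneg _ _)) (Finset.mem_univ u))
  exact mul_pos ((law_nonneg _ _).lt_of_ne' hu) ((law_nonneg _ _).lt_of_ne' hw)

theorem tendsto_two_rpow_mul {d : ℝ} (hd : d < 0) :
    Tendsto (fun n : ℕ => (2 : ℝ) ^ ((n : ℝ) * d)) atTop (𝓝 0) := by
  have h := tendsto_pow_atTop_nhds_zero_of_lt_one (r := (2 : ℝ) ^ d) (by positivity)
    (Real.rpow_lt_one_of_one_lt_of_neg one_lt_two hd)
  refine h.congr fun n => ?_
  rw [mul_comm, Real.rpow_mul zero_le_two, Real.rpow_natCast]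

/-- The average over the codebook of the distance of the induced law of the block from the
i.i.d. output law. -/
def meanCodebookDist (p : Law V) (q : V → Law U) (κ : V → U → Law S) (n : ℕ)
    (ι A : Type*) [Fintype ι] [Fintype A] [DecidableEq ι] [DecidableEq A] (T : Finset ι) : ℝ :=
  ∑ cb, iid ι (cluster A (iid (Fin n) p) (ext₁ n q)) cb *
    ∑ w, |codebookLaw (ext₂ n κ) T cb w - ∏ t, outLaw p q κ (w t)|

/-- Soft covering for superposition codes: the codebook approximates the i.i.d. output law as soon
as its rates exceed the mutual informations. -/
theorem softCovering (p : Law V) (q : V → Law U) (κ : V → U → Law S) {r₁ r₂ : ℝ}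
    (h₁ : info₁ p q κ < r₁) (h₂ : info₂ p q κ < r₂) :
    ∃ ε : ℕ → ℝ, Tendsto ε atTop (𝓝 0) ∧
      ∀ (n : ℕ) (ι A : Type) [Fintype ι] [Fintype A] [DecidableEq ι] [DecidableEq A] [Nonempty A]
        (T : Finset ι), T.Nonempty →
        (2 : ℝ) ^ ((n : ℝ) * r₁) ≤ 8 * (T.card * Fintype.card A) →
        (2 : ℝ) ^ ((n : ℝ) * r₂) ≤ 8 * T.card →
        meanCodebookDist p q κ n ι A T ≤ ε n := by
  classical
  -- The likelihood thresholds are `2 ^ (n c₁)` and `2 ^ (n c₂)`: each `c` above the information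
  -- makes the tail vanish, and below the rate makes the variance vanish.
  obtain ⟨c₁, hc₁, hr₁⟩ := exists_between h₁
  obtain ⟨c₂, hc₂, hr₂⟩ := exists_between h₂
  set t₁ := tail p q κ (fun v u w => κ v u w) (outLaw p q κ) c₁ with ht₁
  set t₂ := tail p q κ (fun v _ w => centreChannel q κ v w) (outLaw p q κ) c₂ with ht₂
  have l₁ : Tendsto t₁ atTop (𝓝 0) := tendsto_tail p q κ _ _ (fun v u w hv hu hw =>
    ⟨(law_nonneg _ _).lt_of_ne' hw, outLaw_pos p q κ hv hu hw⟩) hc₁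
  have l₂ : Tendsto t₂ atTop (𝓝 0) := tendsto_tail p q κ _ _ (fun v u w hv hu hw =>
    ⟨centreChannel_pos q κ hu hw, outLaw_pos p q κ hv hu hw⟩) hc₂
  -- The factor `8` leaves room for up to three alphabet sizes being rounded down, each losing at
  -- most a factor `2`. The bound depends on `n` only, so it serves all key slices simultaneously.
  refine ⟨fun n => √(8 * (2 : ℝ) ^ ((n : ℝ) * (c₁ - r₁)) + 8 * (2 : ℝ) ^ ((n : ℝ) * (c₂ - r₂))) +
    2 * (t₁ n + t₂ n), ?_, ?_⟩
  · have h := ((tendsto_two_rpow_mul (sub_neg.2 hr₁)).const_mul 8).add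
      ((tendsto_two_rpow_mul (sub_neg.2 hr₂)).const_mul 8)
    have h' := ((Real.continuous_sqrt.tendsto _).comp h).add ((l₁.add l₂).const_mul 2)
    simpa using h'
  · intro n ι A _ _ _ _ _ T hT hn₁ hn₂
    have h := softCovering_oneShot (A := A) (iid (Fin n) p) (ext₁ n q) (ext₂ n κ)
      (a₁ := (2 : ℝ) ^ ((n : ℝ) * c₁)) (a₂ := (2 : ℝ) ^ ((n : ℝ) * c₂))
      (by positivity) (by positivity) hT
    simp_rw [outLaw_ext] at h
    refine h.trans (add_le_add (Real.sqrt_le_sqrt (add_le_add ?_ ?_)) ?_)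
    · have hT0 : (0 : ℝ) < T.card := by exact_mod_cast hT.card_pos
      have hA0 : (0 : ℝ) < Fintype.card A := by exact_mod_cast Fintype.card_pos
      rw [div_le_iff₀ (by positivity)]
      calc (2 : ℝ) ^ ((n : ℝ) * c₁) = (2 : ℝ) ^ ((n : ℝ) * (c₁ - r₁)) * 2 ^ ((n : ℝ) * r₁) := by
            rw [← Real.rpow_add two_pos]; congr 1; ring
        _ ≤ (2 : ℝ) ^ ((n : ℝ) * (c₁ - r₁)) * (8 * (T.card * Fintype.card A)) := by gcongr
        _ = _ := by ring
    · have hT0 : (0 : ℝ) < T.card := by exact_mod_cast hT.card_pos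
      rw [div_le_iff₀ hT0]
      calc (2 : ℝ) ^ ((n : ℝ) * c₂) = (2 : ℝ) ^ ((n : ℝ) * (c₂ - r₂)) * 2 ^ ((n : ℝ) * r₂) := by
            rw [← Real.rpow_add two_pos]; congr 1; ring
        _ ≤ (2 : ℝ) ^ ((n : ℝ) * (c₂ - r₂)) * (8 * T.card) := by gcongr
        _ = _ := by ring
    · refine mul_le_mul_of_nonneg_left ?_ zero_le_two
      rw [ht₁, ht₂, tail, tail, mean₃, mean₃, ← Finset.sum_add_distrib]
      refine Finset.sum_le_sum fun w _ => ?_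
      rw [← mean₂_add]
      refine mean₂_mono _ _ fun v u => ?_
      have hκ := law_nonneg (ext₂ n κ v u) w
      rw [← mul_add]
      split_ifs with h' h1 h2 h2 h1 h2
      any_goals linarith
      -- The remaining case is atypical without either tail event; the product formulas for blocks
      -- exclude it.
      rcases h' with h' | h'
      · rw [outLaw_ext] at h'; exact absurd h' h1
      · rw [outLaw_ext, centreChannel_ext] at h'; exact absurd h' h2

end Blocks

/-! ### Product laws, image laws and conditional laws. -/

section Kernels

variable {α β : Type*} [Fintype α] [Fintype β]

/-- The product of two laws. -/
def mulLaw (p : Law α) (q : Law β) : Law (α × β) :=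
  mkLaw (fun a => p a.1 * q a.2) (fun a => mul_nonneg (law_nonneg _ _) (law_nonneg _ _))
    (by rw [Fintype.sum_prod_type]; simp_rw [← Finset.mul_sum]; simp)

@[simp] theorem mulLaw_apply (p : Law α) (q : Law β) (a : α × β) :
    mulLaw p q a = p a.1 * q a.2 := rfl

open Classical in
/-- The image of a law. -/
def mapLaw (f : α → β) (p : Law α) : Law β :=
  mkLaw (fun b => ∑ a, if f a = b then p a else 0)
    (fun b => Finset.sum_nonneg fun a _ => by split_ifs; exacts [law_nonneg _ _, le_rfl])
    (by rw [Finset.sum_comm]; simp)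

theorem sum_mapLaw_mul (f : α → β) (p : Law α) (G : β → ℝ) :
    ∑ b, mapLaw f p b * G b = ∑ a, p a * G (f a) := by
  simp only [mapLaw, mkLaw_apply, Finset.sum_mul, ite_mul, zero_mul]
  rw [Finset.sum_comm]
  refine Finset.sum_congr rfl fun a _ => ?_
  rw [Finset.sum_eq_single (f a) (fun b _ hb => if_neg hb.symm) (by simp), if_pos rfl]

/-- The uniform law. -/
def uniformLaw (α : Type*) [Fintype α] [Nonempty α] : Law α :=
  mkLaw (fun _ => (Fintype.card α : ℝ)⁻¹) (fun _ => by positivity) (by simp)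

/-- Every mass function on a product splits into its marginal and a kernel. -/
theorem exists_kernel [Nonempty β] (P : α → β → ℝ) (hP : ∀ a b, 0 ≤ P a b) :
    ∃ κ : α → Law β, ∀ a b, P a b = (∑ b', P a b') * κ a b := by
  have h : ∀ a, ∃ k : Law β, ∀ b, P a b = (∑ b', P a b') * k b := by
    intro a
    by_cases h0 : ∑ b', P a b' = 0
    -- At a point of marginal mass zero the kernel is arbitrary; the uniform law is a default.
    · refine ⟨uniformLaw β, fun b => ?_⟩
      rw [h0, zero_mul]
      exact (Finset.sum_eq_zero_iff_of_nonneg fun b _ => hP a b).1 h0 b (Finset.mem_univ b)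
    · refine ⟨mkLaw (fun b => P a b / ∑ b', P a b')
        (fun b => div_nonneg (hP a b) (Finset.sum_nonneg fun b _ => hP a b))
        (by rw [← Finset.sum_div, div_self h0]), fun b => ?_⟩
      rw [mkLaw_apply, mul_div_cancel₀ _ h0]
  choose κ hκ using h
  exact ⟨κ, hκ⟩

end Kernels

/-! ### Codes built from a codebook, and their distance to the target. -/

section Codes

variable {X Y Z U V : Type*} [Fintype X] [Fintype Y] [Fintype Z] [Fintype U] [Fintype V]

/-- Triples of sequences as sequences of triples. -/
def zipTriple (X Y Z : Type*) (n : ℕ) :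
    (Fin n → X) × (Fin n → Y) × (Fin n → Z) ≃ (Fin n → X × Y × Z) where
  toFun s t := (s.1 t, s.2.1 t, s.2.2 t)
  invFun w := (fun t => (w t).1, fun t => (w t).2.1, fun t => (w t).2.2)
  left_inv _ := rfl
  right_inv _ := rfl

/-- The joint channel of the three outputs. -/
def jointChannel (κX : V → U → Law X) (κY : V → U → Law Y) (κZ : V → Law Z) (v : V) (u : U) :
    Law (X × Y × Z) :=
  mulLaw (κX v u) (mulLaw (κY v u) (κZ v))

theorem ext₂_jointChannel (κX : V → U → Law X) (κY : V → U → Law Y) (κZ : V → Law Z) {n : ℕ}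
    (v : Fin n → V) (u : Fin n → U) (s : (Fin n → X) × (Fin n → Y) × (Fin n → Z)) :
    ext₂ n (jointChannel κX κY κZ) v u (zipTriple X Y Z n s) =
      ext₂ n κX v u s.1 * (ext₂ n κY v u s.2.1 * ext₁ n κZ v s.2.2) := by
  simp [jointChannel, zipTriple, Finset.prod_mul_distrib]

variable {M₀ M₁ M₂ m₁ m₂ n : ℕ}

/-- The code that draws its messages by `enc` and its outputs by the channels `κY` and `κZ` from
the codeword. -/
def superpositionCode (κY : V → U → Law Y) (κZ : V → Law Z)
    (cb : Fin m₂ × Fin M₀ → (Fin n → V) × (Fin m₁ → Fin n → U))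
    (enc : (Fin n → X) → Fin M₀ → Law (Fin m₁ × Fin m₂))
    (e₁ : Fin m₁ × Fin m₂ → Fin M₁) (d₁ : Fin M₁ → Fin m₁ × Fin m₂)
    (e₂ : Fin m₂ → Fin M₂) (d₂ : Fin M₂ → Fin m₂) : Code X Y Z M₀ M₁ M₂ n where
  node1 x k := mapLaw e₁ (enc x k)
  node2 j k := mapLaw (fun y => (e₂ (d₁ j).2, y))
    (ext₂ n κY (cb ((d₁ j).2, k)).1 ((cb ((d₁ j).2, k)).2 (d₁ j).1))
  node3 j k := ext₁ n κZ (cb (d₂ j, k)).1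

/-- The decoders `d₁`, `d₂` invert the embeddings of the indices into the message alphabets, so the
sums over messages collapse to sums over indices. -/
theorem outputLaw_superpositionCode (QX : Law X) (κY : V → U → Law Y) (κZ : V → Law Z)
    (cb : Fin m₂ × Fin M₀ → (Fin n → V) × (Fin m₁ → Fin n → U))
    (enc : (Fin n → X) → Fin M₀ → Law (Fin m₁ × Fin m₂))
    (e₁ : Fin m₁ × Fin m₂ → Fin M₁) (d₁ : Fin M₁ → Fin m₁ × Fin m₂)
    (e₂ : Fin m₂ → Fin M₂) (d₂ : Fin M₂ → Fin m₂)
    (h₁ : ∀ b, d₁ (e₁ b) = b) (h₂ : ∀ b, d₂ (e₂ b) = b)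
    (s : (Fin n → X) × (Fin n → Y) × (Fin n → Z)) :
    (superpositionCode κY κZ cb enc e₁ d₁ e₂ d₂).outputLaw QX s =
      ∑ k, (M₀ : ℝ)⁻¹ * ∑ b, (∏ t, QX (s.1 t)) * enc s.1 k b *
        (ext₂ n κY (cb (b.2, k)).1 ((cb (b.2, k)).2 b.1) s.2.1 *
          ext₁ n κZ (cb (b.2, k)).1 s.2.2) := by
  classical
  obtain ⟨x, y, z⟩ := s
  refine Finset.sum_congr rfl fun k _ => ?_
  have hj : ∀ j, ∑ j₂, (superpositionCode κY κZ cb enc e₁ d₁ e₂ d₂).inducedLaw QX x y z k j j₂ =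
      mapLaw e₁ (enc x k) j * ((∏ t, QX (x t)) * (M₀ : ℝ)⁻¹ *
        (ext₂ n κY (cb ((d₁ j).2, k)).1 ((cb ((d₁ j).2, k)).2 (d₁ j).1) y *
          ext₁ n κZ (cb ((d₁ j).2, k)).1 z)) := by
    intro j
    have hm : ∀ (b : Fin m₂) (r : Law (Fin n → Y)) (j₂ : Fin M₂),
        mapLaw (fun y => (e₂ b, y)) r (j₂, y) = if j₂ = e₂ b then r y else 0 := by
      intro b r j₂
      simp only [mapLaw, mkLaw_apply, Prod.mk.injEq]
      by_cases h : j₂ = e₂ b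
      · simp [h]
      · simp [h, Ne.symm h]
    simp only [Code.inducedLaw, superpositionCode, hm]
    simp only [mul_ite, ite_mul, mul_zero, zero_mul, Finset.sum_ite_eq', Finset.mem_univ, if_true,
      h₂, one_div]
    ring
  simp only [hj]
  rw [sum_mapLaw_mul, Finset.mul_sum]
  refine Finset.sum_congr rfl fun b _ => ?_
  rw [h₁]
  ring

/-- This sum over uniform indices for a fixed key is the normalizing constant of the likelihood
encoder. -/
theorem codebookLaw_slice (κX : V → U → Law X)
    (cb : Fin m₂ × Fin M₀ → (Fin n → V) × (Fin m₁ → Fin n → U)) (k : Fin M₀) (x : Fin n → X) :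
    codebookLaw (ext₂ n κX) (Finset.univ ×ˢ {k}) cb x =
      ∑ b : Fin m₁ × Fin m₂, (m₂ : ℝ)⁻¹ * (m₁ : ℝ)⁻¹ *
        ext₂ n κX (cb (b.2, k)).1 ((cb (b.2, k)).2 b.1) x := by
  rw [Fintype.sum_prod_type, Finset.sum_comm]
  simp only [codebookLaw, clusterAvg, avg, Finset.sum_product, Finset.sum_singleton,
    Finset.card_product, Finset.card_univ, Fintype.card_fin, Finset.card_singleton, mul_one,
    Finset.mul_sum, mul_assoc]

theorem codebookLaw_univ (κ : V → U → Law X)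
    (cb : Fin m₂ × Fin M₀ → (Fin n → V) × (Fin m₁ → Fin n → U)) (w : Fin n → X) :
    codebookLaw (ext₂ n κ) Finset.univ cb w =
      ∑ k, (M₀ : ℝ)⁻¹ * ∑ b : Fin m₁ × Fin m₂, (m₂ : ℝ)⁻¹ * (m₁ : ℝ)⁻¹ *
        ext₂ n κ (cb (b.2, k)).1 ((cb (b.2, k)).2 b.1) w := by
  simp only [← codebookLaw_slice]
  simp only [codebookLaw, avg, Finset.sum_product, Finset.sum_singleton,
    Finset.card_product, Finset.card_univ, Fintype.card_fin, Finset.card_singleton, mul_one,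
    Fintype.card_prod, Fintype.sum_prod_type, Nat.cast_mul, mul_inv]
  rw [Finset.sum_comm, ← Finset.mul_sum, ← Finset.mul_sum]
  ring

/-- With the likelihood encoder, ideal and induced law share the conditional law of everything else
given `(xⁿ, k)`. The triangle inequality through the ideal law leaves its distance to the target
plus the key-averaged distance of the laws of `xⁿ`. -/
theorem exists_code_of_codebook (QX : Law X) (W : X → Law (Y × Z)) (κX : V → U → Law X)
    (κY : V → U → Law Y) (κZ : V → Law Z)
    (cb : Fin m₂ × Fin M₀ → (Fin n → V) × (Fin m₁ → Fin n → U))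
    (hm₁ : 0 < m₁) (hm₂ : 0 < m₂) (h₁ : m₁ * m₂ ≤ M₁) (h₂ : m₂ ≤ M₂) :
    ∃ c : Code X Y Z M₀ M₁ M₂ n, tvDist (c.outputLaw QX) (iidLaw QX W n) ≤
      (1 / 2) * ((∑ w, |codebookLaw (ext₂ n (jointChannel κX κY κZ)) Finset.univ cb w -
          ∏ t, targetLaw QX W (w t)|) +
        ∑ k, (M₀ : ℝ)⁻¹ * ∑ x, |codebookLaw (ext₂ n κX) (Finset.univ ×ˢ {k}) cb x -
          ∏ t, QX (x t)|) := by
  have : Nonempty (Fin m₁) := ⟨⟨0, hm₁⟩⟩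
  have : Nonempty (Fin m₂) := ⟨⟨0, hm₂⟩⟩
  obtain ⟨e₁⟩ : Nonempty (Fin m₁ × Fin m₂ ↪ Fin M₁) :=
    Function.Embedding.nonempty_of_card_le (by simpa using h₁)
  obtain ⟨e₂⟩ : Nonempty (Fin m₂ ↪ Fin M₂) :=
    Function.Embedding.nonempty_of_card_le (by simpa using h₂)
  -- The likelihood encoder: the posterior of the indices given `(xⁿ, k)` when the indices are
  -- uniform.
  obtain ⟨enc', henc'⟩ := exists_kernel (α := (Fin n → X) × Fin M₀) (β := Fin m₁ × Fin m₂)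
    (fun xk b => (m₂ : ℝ)⁻¹ * (m₁ : ℝ)⁻¹ *
      ext₂ n κX (cb (b.2, xk.2)).1 ((cb (b.2, xk.2)).2 b.1) xk.1)
    (fun xk b => mul_nonneg (by positivity) (law_nonneg _ _))
  set enc : (Fin n → X) → Fin M₀ → Law (Fin m₁ × Fin m₂) := fun x k => enc' (x, k) with hencdef
  have henc : ∀ x k b, (m₂ : ℝ)⁻¹ * (m₁ : ℝ)⁻¹ *
      ext₂ n κX (cb (b.2, k)).1 ((cb (b.2, k)).2 b.1) x =
        codebookLaw (ext₂ n κX) (Finset.univ ×ˢ {k}) cb x * enc x k b := fun x k b => by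
    rw [codebookLaw_slice]
    exact henc' (x, k) b
  refine ⟨superpositionCode κY κZ cb enc e₁ (Function.invFun e₁) e₂ (Function.invFun e₂), ?_⟩
  rw [tvDist]
  refine mul_le_mul_of_nonneg_left ?_ (by norm_num)
  set g : (Fin m₁ × Fin m₂) → Fin M₀ → (Fin n → Y) → (Fin n → Z) → ℝ := fun b k y z =>
    ext₂ n κY (cb (b.2, k)).1 ((cb (b.2, k)).2 b.1) y * ext₁ n κZ (cb (b.2, k)).1 z with hg
  have hg0 : ∀ b k y z, 0 ≤ g b k y z := fun b k y z =>
    mul_nonneg (law_nonneg _ _) (law_nonneg _ _)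
  have hg1 : ∀ b k, ∑ y, ∑ z, g b k y z = 1 := by
    intro b k
    simp only [hg, ← Finset.mul_sum, law_sum, mul_one]
  set D : Fin M₀ → (Fin n → X) → ℝ := fun k x =>
    codebookLaw (ext₂ n κX) (Finset.univ ×ˢ {k}) cb x - ∏ t, QX (x t) with hD
  have hbound : ∀ s : (Fin n → X) × (Fin n → Y) × (Fin n → Z),
      |(superpositionCode κY κZ cb enc e₁ (Function.invFun e₁) e₂
        (Function.invFun e₂)).outputLaw QX s - iidLaw QX W n s| ≤
      |codebookLaw (ext₂ n (jointChannel κX κY κZ)) Finset.univ cb (zipTriple X Y Z n s) -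
        ∏ t, targetLaw QX W (zipTriple X Y Z n s t)| +
      ∑ k, (M₀ : ℝ)⁻¹ * ∑ b, |D k s.1| * enc s.1 k b * g b k s.2.1 s.2.2 := by
    intro s
    -- By Bayes' rule `henc`, ideal minus induced law retains the factor `D k`, the error in the law
    -- of `xⁿ` given `k`.
    have hdiff : codebookLaw (ext₂ n (jointChannel κX κY κZ)) Finset.univ cb
        (zipTriple X Y Z n s) - (superpositionCode κY κZ cb enc e₁ (Function.invFun e₁) e₂
          (Function.invFun e₂)).outputLaw QX s =
        ∑ k, (M₀ : ℝ)⁻¹ * ∑ b, D k s.1 * enc s.1 k b * g b k s.2.1 s.2.2 := by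
      rw [outputLaw_superpositionCode QX κY κZ cb enc e₁ _ e₂ _
        (Function.leftInverse_invFun e₁.injective) (Function.leftInverse_invFun e₂.injective),
        codebookLaw_univ, ← Finset.sum_sub_distrib]
      refine Finset.sum_congr rfl fun k _ => ?_
      rw [← mul_sub, ← Finset.sum_sub_distrib]
      congr 1
      refine Finset.sum_congr rfl fun b _ => ?_
      rw [ext₂_jointChannel, ← mul_assoc, henc]
      simp only [hD, hg]
      ring
    have habs : |∑ k, (M₀ : ℝ)⁻¹ * ∑ b, D k s.1 * enc s.1 k b * g b k s.2.1 s.2.2| ≤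
        ∑ k, (M₀ : ℝ)⁻¹ * ∑ b, |D k s.1| * enc s.1 k b * g b k s.2.1 s.2.2 := by
      refine (Finset.abs_sum_le_sum_abs _ _).trans (Finset.sum_le_sum fun k _ => ?_)
      rw [abs_mul, abs_of_nonneg (by positivity : (0 : ℝ) ≤ (M₀ : ℝ)⁻¹)]
      refine mul_le_mul_of_nonneg_left ?_ (by positivity)
      refine (Finset.abs_sum_le_sum_abs _ _).trans (Finset.sum_le_sum fun b _ => ?_)
      rw [abs_mul, abs_mul, abs_of_nonneg (law_nonneg (enc s.1 k) b), abs_of_nonneg (hg0 _ _ _ _)]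
    rw [← hdiff] at habs
    have htarget : iidLaw QX W n s = ∏ t, targetLaw QX W (zipTriple X Y Z n s t) := rfl
    rw [htarget, add_comm]
    rw [abs_sub_comm] at habs
    exact (abs_sub_le _ _ _).trans (add_le_add habs le_rfl)
  refine (Finset.sum_le_sum fun s _ => hbound s).trans ?_
  rw [Finset.sum_add_distrib]
  refine add_le_add (le_of_eq ((zipTriple X Y Z n).sum_comp fun w =>
    |codebookLaw (ext₂ n (jointChannel κX κY κZ)) Finset.univ cb w -
        ∏ t, targetLaw QX W (w t)|)) (le_of_eq ?_)
  rw [Finset.sum_comm]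
  refine Finset.sum_congr rfl fun k _ => ?_
  rw [← Finset.mul_sum]
  congr 1
  rw [Fintype.sum_prod_type]
  refine Finset.sum_congr rfl fun x _ => ?_
  rw [Fintype.sum_prod_type]
  -- The common conditional laws sum to `1`, which leaves only the error in `xⁿ`.
  calc ∑ y, ∑ z, ∑ b, |D k x| * enc x k b * g b k y z
      = ∑ b, |D k x| * enc x k b * ∑ y, ∑ z, g b k y z := by
        simp only [Finset.mul_sum]
        rw [Finset.sum_congr rfl fun y _ => Finset.sum_comm, Finset.sum_comm]
    _ = |D k x| := by simp only [hg1, mul_one, ← Finset.mul_sum, law_sum]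

/-- The code in which node 2 draws its message uniformly, ignoring node 1. -/
def relayCode [NeZero M₁] [NeZero M₂] (κY : V → Law Y) (κZ : V → Law Z)
    (cb : Fin M₂ × Fin M₀ → (Fin n → V) × (Unit → Fin n → Unit)) : Code X Y Z M₀ M₁ M₂ n where
  node1 _ _ := uniformLaw (Fin M₁)
  node2 _ k := mkLaw (fun a => uniformLaw (Fin M₂) a.1 * ext₁ n κY (cb (a.1, k)).1 a.2)
    (fun a => mul_nonneg (law_nonneg _ _) (law_nonneg _ _))
    (by rw [Fintype.sum_prod_type]; simp_rw [← Finset.mul_sum, law_sum, mul_one, law_sum])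
  node3 j k := ext₁ n κZ (cb (j, k)).1

/-- The joint channel of two outputs that depend on the cloud centre only. -/
def pairChannel (κY : V → Law Y) (κZ : V → Law Z) (v : V) (_ : Unit) : Law (Y × Z) :=
  mulLaw (κY v) (κZ v)

theorem outputLaw_relayCode [NeZero M₁] [NeZero M₂] (QX : Law X) (κY : V → Law Y) (κZ : V → Law Z)
    (cb : Fin M₂ × Fin M₀ → (Fin n → V) × (Unit → Fin n → Unit))
    (s : (Fin n → X) × (Fin n → Y) × (Fin n → Z)) :
    (relayCode κY κZ cb : Code X Y Z M₀ M₁ M₂ n).outputLaw QX s =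
      (∏ t, QX (s.1 t)) * codebookLaw (ext₂ n (pairChannel κY κZ)) Finset.univ cb
        (fun t => (s.2.1 t, s.2.2 t)) := by
  obtain ⟨x, y, z⟩ := s
  have h₁ : (M₁ : ℝ) ≠ 0 := NeZero.ne _
  simp only [Code.outputLaw, Code.inducedLaw, relayCode, uniformLaw, mkLaw_apply, codebookLaw, avg,
    clusterAvg, Finset.card_univ, Fintype.card_prod, Fintype.card_fin, ext₂_apply, pairChannel,
    mulLaw_apply, Finset.prod_mul_distrib, ext₁_apply, Fintype.sum_prod_type, Finset.mul_sum,
    Finset.sum_const, nsmul_eq_mul, Fintype.card_unit, Nat.cast_mul, Nat.cast_one, mul_inv,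
    inv_one, one_mul, one_div]
  rw [Finset.sum_comm]
  refine Finset.sum_congr rfl fun j _ => Finset.sum_congr rfl fun k _ => ?_
  field_simp

/-- Both the target and the induced law have `xⁿ` as an exactly i.i.d. independent factor, which
sums out of the distance. -/
theorem exists_code_of_relay_codebook [NeZero M₁] [NeZero M₂] (QX : Law X) (W : X → Law (Y × Z))
    (QYZ : Y × Z → ℝ) (hQ : ∀ x a, targetLaw QX W (x, a) = QX x * QYZ a)
    (κY : V → Law Y) (κZ : V → Law Z)
    (cb : Fin M₂ × Fin M₀ → (Fin n → V) × (Unit → Fin n → Unit)) :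
    ∃ c : Code X Y Z M₀ M₁ M₂ n, tvDist (c.outputLaw QX) (iidLaw QX W n) ≤
      (1 / 2) * ∑ w, |codebookLaw (ext₂ n (pairChannel κY κZ)) Finset.univ cb w -
          ∏ t, QYZ (w t)| := by
  refine ⟨relayCode κY κZ cb, ?_⟩
  rw [tvDist]
  refine mul_le_mul_of_nonneg_left (le_of_eq ?_) (by norm_num)
  have h : ∀ s : (Fin n → X) × (Fin n → Y) × (Fin n → Z),
      |(relayCode κY κZ cb : Code X Y Z M₀ M₁ M₂ n).outputLaw QX s - iidLaw QX W n s| =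
      iid (Fin n) QX s.1 * |codebookLaw (ext₂ n (pairChannel κY κZ)) Finset.univ cb
        (fun t => (s.2.1 t, s.2.2 t)) - ∏ t, QYZ (s.2.1 t, s.2.2 t)| := by
    intro s
    rw [outputLaw_relayCode, iidLaw]
    simp_rw [hQ]
    rw [Finset.prod_mul_distrib, ← mul_sub, abs_mul, ← iid_apply,
      abs_of_nonneg (law_nonneg _ s.1)]
  simp_rw [h]
  rw [Fintype.sum_prod_type]
  simp_rw [← Finset.mul_sum]
  rw [← Finset.sum_mul, law_sum, one_mul]
  exact (Equiv.arrowProdEquivProdArrow (Fin n) (fun _ => Y) (fun _ => Z)).symm.sum_comp fun w =>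
    |codebookLaw (ext₂ n (pairChannel κY κZ)) Finset.univ cb w - ∏ t, QYZ (w t)|

end Codes

/-! ### Rounding of alphabet sizes, and passage to the closure. -/

section Rates

theorem alphabetSize_pos {n : ℕ} {R : ℝ} (hR : 0 ≤ R) : 0 < alphabetSize n R :=
  Nat.floor_pos.2 (Real.one_le_rpow one_le_two (by positivity))

theorem alphabetSize_le (n : ℕ) (R : ℝ) : (alphabetSize n R : ℝ) ≤ (2 : ℝ) ^ ((n : ℝ) * R) :=
  Nat.floor_le (by positivity)

theorem rpow_le_two_mul_alphabetSize {n : ℕ} {R : ℝ} (hR : 0 ≤ R) :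
    (2 : ℝ) ^ ((n : ℝ) * R) ≤ 2 * alphabetSize n R := by
  have h1 : (1 : ℝ) ≤ alphabetSize n R := by exact_mod_cast alphabetSize_pos hR
  have h2 := Nat.lt_floor_add_one ((2 : ℝ) ^ ((n : ℝ) * R))
  rw [alphabetSize] at h1 ⊢
  linarith

theorem alphabetSize_mono {n : ℕ} {R R' : ℝ} (h : R ≤ R') : alphabetSize n R ≤ alphabetSize n R' :=
  Nat.floor_le_floor (Real.rpow_le_rpow_of_exponent_le one_le_two (by gcongr))

theorem alphabetSize_mul_le (n : ℕ) (R R' : ℝ) :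
    alphabetSize n R * alphabetSize n R' ≤ alphabetSize n (R + R') := by
  refine Nat.le_floor ?_
  rw [Nat.cast_mul, mul_add, Real.rpow_add two_pos]
  exact mul_le_mul (alphabetSize_le n R) (alphabetSize_le n R') (Nat.cast_nonneg _) (by positivity)

/-- Raising all three rates by `ε` turns the weak inequalities of the region into the strict ones
that soft covering needs. -/
theorem mem_closure_of_forall_pos {A : Set (ℝ × ℝ × ℝ)} {R : ℝ × ℝ × ℝ}
    (h : ∀ ε > 0, (R.1 + ε, R.2.1 + ε, R.2.2 + ε) ∈ A) : R ∈ closure A := by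
  have hl : Tendsto (fun n : ℕ => 1 / ((n : ℝ) + 1)) atTop (𝓝 0) :=
    tendsto_one_div_add_atTop_nhds_zero_nat
  have ht : Tendsto (fun n : ℕ => (R.1 + 1 / ((n : ℝ) + 1), R.2.1 + 1 / ((n : ℝ) + 1),
      R.2.2 + 1 / ((n : ℝ) + 1))) atTop (𝓝 (R.1 + 0, R.2.1 + 0, R.2.2 + 0)) :=
    (hl.const_add _).prodMk_nhds ((hl.const_add _).prodMk_nhds (hl.const_add _))
  simp only [add_zero] at ht
  exact mem_closure_of_tendsto ht (Eventually.of_forall fun n => h _ (by positivity))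

end Rates

/-! ### Achievability from strict information inequalities. -/

section Achievability

variable {X Y Z U V : Type*} [Fintype X] [Fintype Y] [Fintype Z] [Fintype U] [Fintype V]

/-- Data processing, from `log t ≤ t - 1` at `t = centreChannel / κ`: the mean of `t - 1` is at most
`0`, because `centreChannel` is the average of `κ` over `u`. -/
theorem info₂_le_info₁ (p : Law V) (q : V → Law U) (κ : V → U → Law X) :
    info₂ p q κ ≤ info₁ p q κ := by
  have hlog : (0 : ℝ) < Real.log 2 := Real.log_pos one_lt_two
  have hpt : info₂ p q κ ≤ mean₃ p q κ fun v u w => Real.logb 2 (κ v u w / outLaw p q κ w) +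
      (centreChannel q κ v w / κ v u w - 1) / Real.log 2 := by
    refine mean₃_mono_of_support p q κ fun v u w hv hu hw => ?_
    have h1 := (law_nonneg (κ v u) w).lt_of_ne' hw
    have h2 := outLaw_pos p q κ hv hu hw
    have h3 := centreChannel_pos q κ hu hw
    rw [Real.logb_div h3.ne' h2.ne', Real.logb_div h1.ne' h2.ne']
    have h4 := Real.log_le_sub_one_of_pos (div_pos h3 h1)
    rw [Real.log_div h3.ne' h1.ne'] at h4
    have h5 : Real.logb 2 (centreChannel q κ v w) - Real.logb 2 (κ v u w) ≤
        (centreChannel q κ v w / κ v u w - 1) / Real.log 2 := by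
      rw [Real.logb, Real.logb, ← sub_div]
      gcongr
    linarith
  have hadd : (mean₃ p q κ fun v u w => Real.logb 2 (κ v u w / outLaw p q κ w) +
      (centreChannel q κ v w / κ v u w - 1) / Real.log 2) = info₁ p q κ +
        mean₃ p q κ fun v u w => (centreChannel q κ v w / κ v u w - 1) / Real.log 2 := by
    simp only [info₁, mean₃, mul_add, mean₂_add, Finset.sum_add_distrib]
  have hle : (mean₃ p q κ fun v u w => (centreChannel q κ v w / κ v u w - 1) / Real.log 2) ≤ 0 := by
    have h : ∀ w, mean₂ p q (fun v u => κ v u w *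
        ((centreChannel q κ v w / κ v u w - 1) / Real.log 2)) ≤
        mean₂ p q (fun v u => centreChannel q κ v w * (Real.log 2)⁻¹ +
          κ v u w * (-(Real.log 2)⁻¹)) := by
      refine fun w => mean₂_mono p q fun v u => ?_
      have hc : 0 ≤ centreChannel q κ v w :=
        Finset.sum_nonneg fun u _ => mul_nonneg (law_nonneg _ _) (law_nonneg _ _)
      -- Off the support of `κ` the left side is `0` and the right side nonnegative, so only an
      -- inequality is available.
      by_cases hw : κ v u w = 0
      · simp only [hw, zero_mul, add_zero]
        positivity
      · refine le_of_eq ?_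
        field_simp
        ring
    refine (Finset.sum_le_sum fun w _ => h w).trans (le_of_eq ?_)
    simp only [mean₂_add, mean₂_mul_const]
    rw [Finset.sum_add_distrib, ← Finset.sum_mul, ← Finset.sum_mul]
    have : ∀ w, mean₂ p q (fun v _ => centreChannel q κ v w) = mean₂ p q (fun v u => κ v u w) := by
      intro w
      simp only [mean₂, centreChannel, ← Finset.sum_mul, law_sum, one_mul]
    simp only [this]
    ring
  linarith

theorem sum_outLaw_jointChannel (p : Law V) (q : V → Law U) (κX : V → U → Law X)
    (κY : V → U → Law Y) (κZ : V → Law Z) (x : X) :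
    ∑ a, outLaw p q (jointChannel κX κY κZ) (x, a) = outLaw p q κX x := by
  simp only [outLaw, jointChannel, mulLaw_apply]
  rw [← mean₂_sum p q (fun (a : Y × Z) v u => κX v u x * (κY v u a.1 * κZ v a.2))]
  simp only [← Finset.mul_sum, Fintype.sum_prod_type, law_sum, mul_one]

/-- The first message carries a cloud index and a satellite index, the second the cloud index alone.
-/
theorem achievable_of_info_lt (QX : Law X) (W : X → Law (Y × Z)) (p : Law V) (q : V → Law U)
    (κX : V → U → Law X) (κY : V → U → Law Y) (κZ : V → Law Z)
    (hout : ∀ w, outLaw p q (jointChannel κX κY κZ) w = targetLaw QX W w) {R₀ R₁ R₂ : ℝ}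
    (h₀ : 0 ≤ R₀) (h₁ : 0 ≤ R₁) (h₂ : 0 ≤ R₂) (hX₁ : info₁ p q κX < R₁) (hX₂ : info₂ p q κX < R₂)
    (hJ₁ : info₁ p q (jointChannel κX κY κZ) < R₁ + R₀)
    (hJ₂ : info₂ p q (jointChannel κX κY κZ) < R₂ + R₀) : Achievable QX W (R₀, R₁, R₂) := by
  have houtX : ∀ x, outLaw p q κX x = QX x := by
    intro x
    rw [← sum_outLaw_jointChannel p q κX κY κZ]
    simp only [hout, targetLaw, ← Finset.mul_sum, law_sum, mul_one]
  -- The cloud rate must fit on both links; the satellites get the remaining `R₁ - r`. If `R₁ < R₂`,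
  -- the cloud conditions at rate `R₁` follow from `info₂ ≤ info₁`.
  set r := min R₁ R₂ with hr
  have hr0 : 0 ≤ r := le_min h₁ h₂
  have hrX : info₂ p q κX < r := lt_min ((info₂_le_info₁ p q κX).trans_lt hX₁) hX₂
  have hrJ : info₂ p q (jointChannel κX κY κZ) < r + R₀ := by
    rw [hr, min_add]
    exact lt_min ((info₂_le_info₁ p q _).trans_lt hJ₁) hJ₂
  obtain ⟨ε, hε, hεb⟩ := softCovering p q (jointChannel κX κY κZ) hJ₁ hrJ
  obtain ⟨δ, hδ, hδb⟩ := softCovering p q κX hX₁ hrX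
  have hcode : ∀ n : ℕ, ∃ c : Code X Y Z (alphabetSize n R₀) (alphabetSize n R₁)
      (alphabetSize n R₂) n, tvDist (c.outputLaw QX) (iidLaw QX W n) ≤ 1 / 2 * (ε n + δ n) := by
    intro n
    set m₂ := alphabetSize n r with hm₂
    set m₁ := alphabetSize n (R₁ - r) with hm₁
    set M₀ := alphabetSize n R₀ with hM₀
    have hr1 : 0 ≤ R₁ - r := sub_nonneg.2 (min_le_left _ _)
    have pm₂ : 0 < m₂ := alphabetSize_pos hr0
    have pm₁ : 0 < m₁ := alphabetSize_pos hr1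
    have pM₀ : 0 < M₀ := alphabetSize_pos h₀
    have pM₀' : (0 : ℝ) < M₀ := by exact_mod_cast pM₀
    have bm₂ : (2 : ℝ) ^ ((n : ℝ) * r) ≤ 2 * m₂ := rpow_le_two_mul_alphabetSize hr0
    have bm₁ : (2 : ℝ) ^ ((n : ℝ) * (R₁ - r)) ≤ 2 * m₁ := rpow_le_two_mul_alphabetSize hr1
    have bM₀ : (2 : ℝ) ^ ((n : ℝ) * R₀) ≤ 2 * M₀ := rpow_le_two_mul_alphabetSize h₀
    have b₁ : (2 : ℝ) ^ ((n : ℝ) * R₁) ≤ 4 * (m₂ * m₁) := by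
      have : (2 : ℝ) ^ ((n : ℝ) * R₁) =
          (2 : ℝ) ^ ((n : ℝ) * r) * (2 : ℝ) ^ ((n : ℝ) * (R₁ - r)) := by
        rw [← Real.rpow_add two_pos]; congr 1; ring
      rw [this]
      calc _ ≤ (2 * (m₂ : ℝ)) * (2 * m₁) := mul_le_mul bm₂ bm₁ (by positivity) (by positivity)
        _ = _ := by ring
    have : Nonempty (Fin m₁) := ⟨⟨0, pm₁⟩⟩
    have : Nonempty (Fin m₂) := ⟨⟨0, pm₂⟩⟩
    have : Nonempty (Fin M₀) := ⟨⟨0, pM₀⟩⟩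
    have e₁ : meanCodebookDist p q (jointChannel κX κY κZ) n (Fin m₂ × Fin M₀) (Fin m₁)
        Finset.univ ≤ ε n := by
      refine hεb n _ _ _ Finset.univ_nonempty ?_ ?_
      · rw [Finset.card_univ, Fintype.card_prod, Fintype.card_fin, Fintype.card_fin,
          Fintype.card_fin, mul_add, Real.rpow_add two_pos, Nat.cast_mul]
        calc _ ≤ (4 * ((m₂ : ℝ) * m₁)) * (2 * M₀) :=
              mul_le_mul b₁ bM₀ (by positivity) (by positivity)
          _ = _ := by ring
      · rw [Finset.card_univ, Fintype.card_prod, Fintype.card_fin, Fintype.card_fin, mul_add,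
          Real.rpow_add two_pos, Nat.cast_mul]
        calc _ ≤ (2 * (m₂ : ℝ)) * (2 * M₀) := mul_le_mul bm₂ bM₀ (by positivity) (by positivity)
          _ ≤ _ := by nlinarith [mul_nonneg (Nat.cast_nonneg (α := ℝ) m₂) pM₀'.le]
    have e₂ : ∀ k : Fin M₀, meanCodebookDist p q κX n (Fin m₂ × Fin M₀) (Fin m₁)
        (Finset.univ ×ˢ {k}) ≤ δ n := by
      intro k
      have hc : (Finset.univ ×ˢ {k} : Finset (Fin m₂ × Fin M₀)).card = m₂ := by
        simp
      refine hδb n _ _ _ (Finset.univ_nonempty.product (Finset.singleton_nonempty k)) ?_ ?_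
      · rw [hc, Fintype.card_fin]
        nlinarith [mul_nonneg (Nat.cast_nonneg (α := ℝ) m₂) (Nat.cast_nonneg (α := ℝ) m₁)]
      · rw [hc]
        linarith [Nat.cast_nonneg (α := ℝ) m₂]
    -- Applied to the sum of both errors, so that one codebook is good for the joint law and, on
    -- average over the key, for the slices.
    obtain ⟨cb, hcb⟩ := exists_le_of_mean_le
      (iid (Fin m₂ × Fin M₀) (cluster (Fin m₁) (iid (Fin n) p) (ext₁ n q)))
      (fun cb => (∑ w, |codebookLaw (ext₂ n (jointChannel κX κY κZ)) Finset.univ cb w -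
          ∏ t, outLaw p q (jointChannel κX κY κZ) (w t)|) +
        ∑ k, (M₀ : ℝ)⁻¹ * ∑ x, |codebookLaw (ext₂ n κX) (Finset.univ ×ˢ {k}) cb x -
          ∏ t, outLaw p q κX (x t)|) (B := ε n + δ n) (by
        simp_rw [mul_add]
        rw [Finset.sum_add_distrib]
        refine add_le_add e₁ ?_
        simp_rw [Finset.mul_sum (Finset.univ : Finset (Fin M₀))]
        rw [Finset.sum_comm]
        have hk : ∀ k : Fin M₀, ∑ cb,
            iid (Fin m₂ × Fin M₀) (cluster (Fin m₁) (iid (Fin n) p) (ext₁ n q)) cb *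
            ((M₀ : ℝ)⁻¹ * ∑ x, |codebookLaw (ext₂ n κX) (Finset.univ ×ˢ {k}) cb x -
              ∏ t, outLaw p q κX (x t)|) ≤ (M₀ : ℝ)⁻¹ * δ n := by
          intro k
          refine le_trans (le_of_eq ?_) (mul_le_mul_of_nonneg_left (e₂ k) (by positivity))
          rw [meanCodebookDist, Finset.mul_sum]
          exact Finset.sum_congr rfl fun cb _ => by ring
        refine (Finset.sum_le_sum fun k _ => hk k).trans (le_of_eq ?_)
        simp only [Finset.sum_const, Finset.card_univ, Fintype.card_fin, nsmul_eq_mul]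
        field_simp)
    obtain ⟨c, hc⟩ := exists_code_of_codebook (M₁ := alphabetSize n R₁) (M₂ := alphabetSize n R₂)
      QX W κX κY κZ cb pm₁ pm₂
      ((alphabetSize_mul_le n _ _).trans (by rw [sub_add_cancel]))
      (alphabetSize_mono (min_le_right _ _))
    simp only [hout, houtX] at hcb
    exact ⟨c, hc.trans (mul_le_mul_of_nonneg_left hcb (by norm_num))⟩
  choose c hc using hcode
  refine ⟨h₀, h₁, h₂, c, squeeze_zero (fun n => ?_) hc ?_⟩
  · exact mul_nonneg (by norm_num) (Finset.sum_nonneg fun _ _ => abs_nonneg _)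
  · simpa using (hε.add hδ).const_mul (1 / 2 : ℝ)

/-- The codebook has one satellite per cloud, so both covering conditions reduce to the single one
on `R₂ + R₀`. -/
theorem achievable_of_indep (QX : Law X) (W : X → Law (Y × Z)) (QYZ : Y × Z → ℝ)
    (hQ : ∀ x a, targetLaw QX W (x, a) = QX x * QYZ a) (p : Law V) (q : V → Law Unit)
    (κY : V → Law Y) (κZ : V → Law Z)
    (hout : ∀ w, outLaw p q (pairChannel κY κZ) w = QYZ w) {R₀ R₁ R₂ : ℝ}
    (h₀ : 0 ≤ R₀) (h₁ : 0 ≤ R₁) (h₂ : 0 ≤ R₂)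
    (h : info₁ p q (pairChannel κY κZ) < R₂ + R₀) : Achievable QX W (R₀, R₁, R₂) := by
  obtain ⟨ε, hε, hεb⟩ := softCovering p q (pairChannel κY κZ) h
    ((info₂_le_info₁ _ _ _).trans_lt h)
  have hcode : ∀ n : ℕ, ∃ c : Code X Y Z (alphabetSize n R₀) (alphabetSize n R₁)
      (alphabetSize n R₂) n, tvDist (c.outputLaw QX) (iidLaw QX W n) ≤ 1 / 2 * ε n := by
    intro n
    set M₁ := alphabetSize n R₁
    set M₂ := alphabetSize n R₂
    set M₀ := alphabetSize n R₀
    have pM₁ : 0 < M₁ := alphabetSize_pos h₁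
    have pM₂ : 0 < M₂ := alphabetSize_pos h₂
    have pM₀ : 0 < M₀ := alphabetSize_pos h₀
    have : NeZero M₁ := ⟨pM₁.ne'⟩
    have : NeZero M₂ := ⟨pM₂.ne'⟩
    have : NeZero M₀ := ⟨pM₀.ne'⟩
    have bM₂ : (2 : ℝ) ^ ((n : ℝ) * R₂) ≤ 2 * M₂ := rpow_le_two_mul_alphabetSize h₂
    have bM₀ : (2 : ℝ) ^ ((n : ℝ) * R₀) ≤ 2 * M₀ := rpow_le_two_mul_alphabetSize h₀
    have b : (2 : ℝ) ^ ((n : ℝ) * (R₂ + R₀)) ≤ 8 * ((M₂ : ℝ) * M₀) := by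
      rw [mul_add, Real.rpow_add two_pos]
      calc _ ≤ (2 * (M₂ : ℝ)) * (2 * M₀) := mul_le_mul bM₂ bM₀ (by positivity) (by positivity)
        _ ≤ _ := by
          nlinarith [mul_nonneg (Nat.cast_nonneg (α := ℝ) M₂) (Nat.cast_nonneg (α := ℝ) M₀)]
    have e := hεb n (Fin M₂ × Fin M₀) Unit Finset.univ Finset.univ_nonempty
      (by simpa using b) (by simpa using b)
    obtain ⟨cb, hcb⟩ := exists_le_of_mean_le _ _ e
    obtain ⟨c, hc⟩ := exists_code_of_relay_codebook (M₁ := M₁) QX W QYZ hQ κY κZ cb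
    simp only [hout] at hcb
    exact ⟨c, hc.trans (mul_le_mul_of_nonneg_left hcb (by norm_num))⟩
  choose c hc using hcode
  refine ⟨h₀, h₁, h₂, c, squeeze_zero (fun n => ?_) hc ?_⟩
  · exact mul_nonneg (by norm_num) (Finset.sum_nonneg fun _ _ => abs_nonneg _)
  · simpa using hε.const_mul (1 / 2 : ℝ)

end Achievability

/-! ### Marginals, independence, Markov chains and mutual information. -/

section Marginals

variable {Ω A B C D U V S : Type*} [Fintype Ω] [Fintype A] [Fintype B] [Fintype U] [Fintype V]
  [Fintype S]

theorem marg_congr (P : Ω → ℝ) {f : Ω → C} {g : Ω → D} {c : C} {d : D}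
    (h : ∀ ω, f ω = c ↔ g ω = d) : marg P f c = marg P g d := by
  classical
  refine Finset.sum_congr rfl fun ω _ => ?_
  by_cases hc : f ω = c
  · rw [if_pos hc, if_pos ((h ω).1 hc)]
  · rw [if_neg hc, if_neg fun hd => hc ((h ω).2 hd)]

theorem marg_eq_zero (P : Ω → ℝ) {f : Ω → C} {c : C} (h : ∀ ω, f ω ≠ c) : marg P f c = 0 :=
  Finset.sum_eq_zero fun ω _ => if_neg (h ω)

theorem marg_of_injective (P : Ω → ℝ) {f : Ω → C} (hf : Function.Injective f) (ω : Ω) :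
    marg P f (f ω) = P ω := by
  rw [marg, Finset.sum_eq_single ω (fun b _ hb => if_neg fun h => hb (hf h)) (by simp),
    if_pos rfl]

theorem marg_nonneg {P : Ω → ℝ} (hP : ∀ ω, 0 ≤ P ω) (f : Ω → C) (c : C) : 0 ≤ marg P f c :=
  Finset.sum_nonneg fun ω _ => by split_ifs; exacts [hP ω, le_rfl]

theorem sum_marg_mul (P : Ω → ℝ) (f : Ω → A) (φ : A → ℝ) :
    ∑ a, marg P f a * φ a = ∑ ω, P ω * φ (f ω) := by
  simp only [marg, Finset.sum_mul, ite_mul, zero_mul]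
  rw [Finset.sum_comm]
  refine Finset.sum_congr rfl fun ω _ => ?_
  rw [Finset.sum_eq_single (f ω) (fun b _ hb => if_neg hb.symm) (by simp), if_pos rfl]

theorem sum_marg (P : Ω → ℝ) (f : Ω → A) : ∑ a, marg P f a = ∑ ω, P ω := by
  simpa using sum_marg_mul P f 1

theorem marg_marg (P : Ω → ℝ) (f : Ω → A) (φ : A → C) :
    marg (marg P f) φ = marg P (fun ω => φ (f ω)) := by
  classical
  funext c
  simpa [marg] using sum_marg_mul P f (fun a => if φ a = c then 1 else 0)

theorem sum_marg_pair_right (P : Ω → ℝ) (f : Ω → C) (g : Ω → B) (c : C) :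
    ∑ b, marg P (fun ω => (f ω, g ω)) (c, b) = marg P f c := by
  classical
  simp only [marg]
  rw [Finset.sum_comm]
  refine Finset.sum_congr rfl fun ω _ => ?_
  refine (Finset.sum_eq_single (g ω) (fun b _ hb => if_neg fun h => hb (Prod.ext_iff.1 h).2.symm)
    (by simp)).trans ?_
  by_cases h : f ω = c
  · rw [if_pos (by rw [h]), if_pos h]
  · rw [if_neg fun h' => h (Prod.ext_iff.1 h').1, if_neg h]

theorem sum_marg_pair_left (P : Ω → ℝ) (f : Ω → A) (g : Ω → C) (c : C) :
    ∑ a, marg P (fun ω => (f ω, g ω)) (a, c) = marg P g c := by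
  rw [← sum_marg_pair_right P g f c]
  exact Finset.sum_congr rfl fun a _ => marg_congr P fun ω => by simp [and_comm]

theorem marg_pair_le_right {P : Ω → ℝ} (hP : ∀ ω, 0 ≤ P ω) (f : Ω → A) (g : Ω → C) (a : A)
    (c : C) : marg P (fun ω => (f ω, g ω)) (a, c) ≤ marg P g c := by
  rw [← sum_marg_pair_left P f g c]
  exact Finset.single_le_sum (f := fun a => marg P (fun ω => (f ω, g ω)) (a, c))
    (fun a _ => marg_nonneg hP _ _) (Finset.mem_univ a)

open Classical in
theorem marg_comp_pair (P : Ω → ℝ) (f : Ω → A) (φ : A → C) (g : Ω → D) (c : C) (d : D) :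
    marg P (fun ω => (φ (f ω), g ω)) (c, d) =
      ∑ a, if φ a = c then marg P (fun ω => (f ω, g ω)) (a, d) else 0 := by
  have h : ∀ a, (if φ a = c then marg P (fun ω => (f ω, g ω)) (a, d) else 0) =
      marg P (fun ω => (f ω, (φ (f ω), g ω))) (a, (c, d)) := by
    intro a
    split_ifs with ha
    · exact marg_congr P fun ω => by
        simp only [Prod.mk.injEq]
        exact ⟨fun h => ⟨h.1, by rw [h.1, ha], h.2⟩, fun h => ⟨h.1, h.2.2⟩⟩
    · exact (marg_eq_zero P fun ω hω => ha (by
        simp only [Prod.mk.injEq] at hω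
        rw [← hω.1, hω.2.1])).symm
  simp only [h]
  exact (sum_marg_pair_left P f (fun ω => (φ (f ω), g ω)) (c, d)).symm

theorem Indep.symm {P : Ω → ℝ} {f : Ω → C} {g : Ω → D} (h : Indep P f g) : Indep P g f := by
  intro d c
  rw [mul_comm, ← h c d]
  exact marg_congr P fun ω => by simp [and_comm]

theorem Indep.comp_left {P : Ω → ℝ} {f : Ω → A} {g : Ω → D} (h : Indep P f g) (φ : A → C) :
    Indep P (fun ω => φ (f ω)) g := by
  classical
  intro c d
  rw [marg_comp_pair, ← marg_marg P f φ, marg, Finset.sum_mul]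
  refine Finset.sum_congr rfl fun a _ => ?_
  rw [ite_mul, zero_mul, h a d]

theorem MarkovChain.comp_left {P : Ω → ℝ} {f : Ω → A} {g : Ω → B} {k : Ω → D}
    (h : MarkovChain P f g k) (φ : A → C) : MarkovChain P (fun ω => φ (f ω)) g k := by
  classical
  intro c b d
  rw [marg_comp_pair P f φ (fun ω => (g ω, k ω)), marg_comp_pair P f φ g, Finset.sum_mul,
    Finset.sum_mul]
  refine Finset.sum_congr rfl fun a _ => ?_
  rw [ite_mul, ite_mul, zero_mul, zero_mul, h a b d]

/-- An injective copy of `f` determines `f`, so nothing random is left in `f` given the copy. This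
covers the choice `V = Y`. -/
theorem markovChain_of_injective (P : Ω → ℝ) (f : Ω → C) {e : C → B} (he : Function.Injective e)
    (k : Ω → D) : MarkovChain P f (fun ω => e (f ω)) k := by
  intro c b d
  by_cases hb : e c = b
  · subst hb
    rw [mul_comm]
    congr 1
    · exact marg_congr P fun ω => by simp [he.eq_iff]
    · exact marg_congr P fun ω => by simp [he.eq_iff]
  · rw [marg_eq_zero P (f := fun ω => (f ω, e (f ω), k ω)), marg_eq_zero P
      (f := fun ω => (f ω, e (f ω))), zero_mul, zero_mul]
    · intro ω h
      simp only [Prod.mk.injEq] at h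
      exact hb (by rw [← h.1, h.2])
    · intro ω h
      simp only [Prod.mk.injEq] at h
      exact hb (by rw [← h.1, h.2.1])

/-- A law whose mass function is a marginal. -/
def margLaw (P : Law Ω) (f : Ω → A) : Law A :=
  mkLaw (marg P f) (marg_nonneg (law_nonneg P) f) (by rw [sum_marg, law_sum])

@[simp] theorem coe_margLaw (P : Law Ω) (f : Ω → A) : (margLaw P f : A → ℝ) = marg P f := rfl

theorem marg_pair_le_left {P : Ω → ℝ} (hP : ∀ ω, 0 ≤ P ω) (f : Ω → C) (g : Ω → B) (c : C)
    (b : B) : marg P (fun ω => (f ω, g ω)) (c, b) ≤ marg P f c := by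
  rw [← sum_marg_pair_right P f g c]
  exact Finset.single_le_sum (f := fun b => marg P (fun ω => (f ω, g ω)) (c, b))
    (fun b _ => marg_nonneg hP _ _) (Finset.mem_univ b)

/-- The contribution of `(a, b)` to the divergence of the joint law from the product law. -/
def divTerm (P : Ω → ℝ) (f : Ω → A) (g : Ω → B) (a : A) (b : B) : ℝ :=
  marg P f a * marg P g b * InformationTheory.klFun
    (marg P (fun ω => (f ω, g ω)) (a, b) / (marg P f a * marg P g b))

theorem marg_pair_eq_zero {P : Ω → ℝ} (hP : ∀ ω, 0 ≤ P ω) {f : Ω → A} {g : Ω → B} {a : A} {b : B}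
    (h : marg P f a * marg P g b = 0) : marg P (fun ω => (f ω, g ω)) (a, b) = 0 := by
  rcases mul_eq_zero.1 h with h0 | h0
  · exact le_antisymm (h0 ▸ marg_pair_le_left hP f g a b) (marg_nonneg hP _ _)
  · exact le_antisymm (h0 ▸ marg_pair_le_right hP f g a b) (marg_nonneg hP _ _)

theorem divTerm_nonneg {P : Ω → ℝ} (hP : ∀ ω, 0 ≤ P ω) (f : Ω → A) (g : Ω → B) (a : A) (b : B) :
    0 ≤ divTerm P f g a b := by
  have h := mul_nonneg (marg_nonneg hP f a) (marg_nonneg hP g b)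
  exact mul_nonneg h (InformationTheory.klFun_nonneg (div_nonneg (marg_nonneg hP _ _) h))

/-- Since `klFun t = t log t + 1 - t`, the correction terms sum to the total product mass minus the
total joint mass, which is `0`. Mutual information thus becomes a sum of nonnegative terms. -/
theorem sum_divTerm (P : Law Ω) (f : Ω → A) (g : Ω → B) :
    ∑ a, ∑ b, divTerm P f g a b = mutualInfo P f g * Real.log 2 := by
  have hlog : Real.log 2 ≠ 0 := (Real.log_pos one_lt_two).ne'
  set M : A → B → ℝ := fun a b => marg P (fun ω => (f ω, g ω)) (a, b) with hM
  set N : A → B → ℝ := fun a b => marg P f a * marg P g b with hN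
  have hsM : ∑ a, ∑ b, M a b = 1 := by
    simp only [hM, sum_marg_pair_right, sum_marg, law_sum]
  have hsN : ∑ a, ∑ b, N a b = 1 := by
    simp only [hN, ← Finset.mul_sum, sum_marg, law_sum, mul_one]
  have hkl : ∀ a b, divTerm P f g a b =
      M a b * Real.logb 2 (M a b / N a b) * Real.log 2 + N a b - M a b := by
    intro a b
    change N a b * InformationTheory.klFun (M a b / N a b) = _
    by_cases hab : N a b = 0
    · have : M a b = 0 := marg_pair_eq_zero (law_nonneg P) hab
      simp [hab, this]
    · rw [InformationTheory.klFun, Real.logb]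
      field_simp
  simp only [hkl, Finset.sum_add_distrib, Finset.sum_sub_distrib, hsM, hsN, ← Finset.sum_mul]
  rw [add_sub_cancel_right]
  rfl

theorem mutualInfo_nonneg (P : Law Ω) (f : Ω → A) (g : Ω → B) : 0 ≤ mutualInfo P f g := by
  refine nonneg_of_mul_nonneg_left ?_ (Real.log_pos one_lt_two)
  rw [← sum_divTerm]
  exact Finset.sum_nonneg fun a _ => Finset.sum_nonneg fun b _ =>
    divTerm_nonneg (law_nonneg P) f g a b

/-- Nonnegative terms with sum zero all vanish, and `klFun` vanishes only at ratio `1`. -/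
theorem indep_of_mutualInfo_nonpos (P : Law Ω) (f : Ω → A) (g : Ω → B)
    (h : mutualInfo P f g ≤ 0) : Indep P f g := by
  have hpos := divTerm_nonneg (law_nonneg P) f g
  have hzero := sum_divTerm P f g
  rw [le_antisymm h (mutualInfo_nonneg P f g), zero_mul] at hzero
  intro a b
  have h1 := (Finset.sum_eq_zero_iff_of_nonneg
    (fun a _ => Finset.sum_nonneg fun b _ => hpos a b)).1 hzero a (Finset.mem_univ a)
  have h2 := (Finset.sum_eq_zero_iff_of_nonneg (fun b _ => hpos a b)).1 h1 b (Finset.mem_univ b)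
  rcases mul_eq_zero.1 h2 with h3 | h3
  · rw [h3, marg_pair_eq_zero (law_nonneg P) h3]
  · rw [InformationTheory.klFun_eq_zero_iff (div_nonneg (marg_nonneg (law_nonneg P) _ _)
      (mul_nonneg (marg_nonneg (law_nonneg P) _ _) (marg_nonneg (law_nonneg P) _ _)))] at h3
    exact eq_of_div_eq_one h3

section Factorization

theorem marg_inputs_of_factorization
    (P : Law Ω) (f : Ω → S) (gU : Ω → U) (gV : Ω → V) (p : Law V) (q : V → Law U)
    (κ : V → U → Law S)
    (h : ∀ w u v, marg P (fun ω => (f ω, (gU ω, gV ω))) (w, (u, v)) = p v * (q v u * κ v u w))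
    (u : U) (v : V) :
    marg P (fun ω => (gU ω, gV ω)) (u, v) = p v * q v u := by
  rw [← sum_marg_pair_left P f (fun ω => (gU ω, gV ω)) (u, v)]
  simp only [h, ← Finset.mul_sum, law_sum, mul_one]

theorem marg_output_of_factorization
    (P : Law Ω) (f : Ω → S) (gU : Ω → U) (gV : Ω → V) (p : Law V) (q : V → Law U)
    (κ : V → U → Law S)
    (h : ∀ w u v, marg P (fun ω => (f ω, (gU ω, gV ω))) (w, (u, v)) = p v * (q v u * κ v u w))
    (w : S) : marg P f w = outLaw p q κ w := by
  rw [← sum_marg_pair_right P f (fun ω => (gU ω, gV ω)) w, Fintype.sum_prod_type,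
    Finset.sum_comm]
  simp only [h, outLaw, mean₂, Finset.mul_sum]

theorem mutualInfo_eq_info₁
    (P : Law Ω) (f : Ω → S) (gU : Ω → U) (gV : Ω → V) (p : Law V) (q : V → Law U)
    (κ : V → U → Law S)
    (h : ∀ w u v, marg P (fun ω => (f ω, (gU ω, gV ω))) (w, (u, v)) = p v * (q v u * κ v u w)) : mutualInfo P f (fun ω => (gU ω, gV ω)) = info₁ p q κ := by
  rw [mutualInfo, info₁, mean₃]
  refine Finset.sum_congr rfl fun w _ => ?_
  rw [Fintype.sum_prod_type, Finset.sum_comm, mean₂]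
  refine Finset.sum_congr rfl fun v _ => ?_
  rw [Finset.mul_sum]
  refine Finset.sum_congr rfl fun u _ => ?_
  rw [h, marg_inputs_of_factorization P f gU gV p q κ h,
    marg_output_of_factorization P f gU gV p q κ h]
  by_cases h0 : p v * q v u = 0
  · rw [← mul_assoc (p v), ← mul_assoc (p v), h0, zero_mul, zero_mul, zero_mul]
  · rw [← mul_assoc, mul_comm (outLaw p q κ w), mul_div_mul_left _ _ h0]
    ring

theorem mutualInfo_eq_info₂
    (P : Law Ω) (f : Ω → S) (gU : Ω → U) (gV : Ω → V) (p : Law V) (q : V → Law U)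
    (κ : V → U → Law S)
    (h : ∀ w u v, marg P (fun ω => (f ω, (gU ω, gV ω))) (w, (u, v)) = p v * (q v u * κ v u w)) : mutualInfo P f gV = info₂ p q κ := by
  have hfV : ∀ w v, marg P (fun ω => (f ω, gV ω)) (w, v) = p v * centreChannel q κ v w := by
    intro w v
    rw [← sum_marg_pair_left P gU (fun ω => (f ω, gV ω)) (w, v), centreChannel, Finset.mul_sum]
    refine Finset.sum_congr rfl fun u _ => ?_
    rw [← h]
    exact marg_congr P fun ω => by simp only [Prod.mk.injEq]; tauto
  have hV : ∀ v, marg P gV v = p v := by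
    intro v
    rw [← sum_marg_pair_left P gU gV v]
    simp only [marg_inputs_of_factorization P f gU gV p q κ h, ← Finset.mul_sum, law_sum, mul_one]
  rw [mutualInfo, info₂, mean₃]
  refine Finset.sum_congr rfl fun w _ => ?_
  rw [mean₂]
  refine Finset.sum_congr rfl fun v _ => ?_
  rw [hfV, hV, marg_output_of_factorization P f gU gV p q κ h]
  have : ∀ x, ∑ u, q v u * (κ v u w * x) = centreChannel q κ v w * x := by
    intro x
    rw [centreChannel, Finset.sum_mul]
    exact Finset.sum_congr rfl fun u _ => by ring
  rw [this]
  by_cases h0 : p v = 0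
  · simp [h0]
  · rw [mul_comm (outLaw p q κ w), mul_div_mul_left _ _ h0]
    ring

end Factorization

end Marginals

theorem law_nonempty {α : Type*} [Fintype α] (p : Law α) : Nonempty α := by
  by_contra h
  rw [not_nonempty_iff] at h
  have := law_sum p
  simp at this

/-! ### The inner bound: from auxiliary laws to channels. -/

section InnerBound

variable {X Y Z U V : Type*} [Fintype X] [Fintype Y] [Fintype Z] [Fintype U] [Fintype V]

/-- `X - (U, V) - Y` separates `κX` from `κY`, and `(X, Y, U) - V - Z` makes the channel to `Z`
depend on the cloud centre only, which is all that node 3 knows. -/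
theorem exists_channels_of_mem_auxLaws {QX : Law X} {W : X → Law (Y × Z)}
    {P : Law (X × Y × Z × U × V)} (hP : P ∈ auxLaws QX W U V) :
    ∃ (p : Law V) (q : V → Law U) (κX : V → U → Law X) (κY : V → U → Law Y) (κZ : V → Law Z),
      (∀ x u v, marg P (fun ω => (ω.1, (ω.2.2.2.1, ω.2.2.2.2))) (x, (u, v)) =
        p v * (q v u * κX v u x)) ∧
      ∀ w u v, marg P (fun ω => ((ω.1, ω.2.1, ω.2.2.1), (ω.2.2.2.1, ω.2.2.2.2))) (w, (u, v)) =
        p v * (q v u * jointChannel κX κY κZ v u w) := by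
  obtain ⟨-, hm₁, hm₂⟩ := hP
  obtain ⟨⟨x₀, y₀, z₀, u₀, v₀⟩⟩ := law_nonempty P
  have : Nonempty X := ⟨x₀⟩
  have : Nonempty Y := ⟨y₀⟩
  have : Nonempty Z := ⟨z₀⟩
  have : Nonempty U := ⟨u₀⟩
  have hP0 := law_nonneg P
  set gX : X × Y × Z × U × V → X := fun ω => ω.1 with hgX
  set gY : X × Y × Z × U × V → Y := fun ω => ω.2.1 with hgY
  set gZ : X × Y × Z × U × V → Z := fun ω => ω.2.2.1 with hgZ
  set gU : X × Y × Z × U × V → U := fun ω => ω.2.2.2.1 with hgU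
  set gV : X × Y × Z × U × V → V := fun ω => ω.2.2.2.2 with hgV
  have hm₁' : MarkovChain P gX (fun ω => (gU ω, gV ω)) gY := hm₁
  have hm₂' : MarkovChain P (fun ω => (gX ω, gY ω, gU ω)) gV gZ := hm₂
  obtain ⟨q, hq⟩ := exists_kernel (fun v u => marg P (fun ω => (gU ω, gV ω)) (u, v))
    fun v u => marg_nonneg hP0 _ _
  obtain ⟨κX, hκX⟩ := exists_kernel
    (fun uv x => marg P (fun ω => (gX ω, (gU ω, gV ω))) (x, uv)) fun uv x => marg_nonneg hP0 _ _
  obtain ⟨κY, hκY⟩ := exists_kernel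
    (fun uv y => marg P (fun ω => ((gU ω, gV ω), gY ω)) (uv, y)) fun uv x => marg_nonneg hP0 _ _
  obtain ⟨κZ, hκZ⟩ := exists_kernel
    (fun v z => marg P (fun ω => (gV ω, gZ ω)) (v, z)) fun v z => marg_nonneg hP0 _ _
  simp only [sum_marg_pair_left P gU gV] at hq
  simp only [sum_marg_pair_left P gX (fun ω => (gU ω, gV ω)), hq] at hκX
  simp only [sum_marg_pair_right P (fun ω => (gU ω, gV ω)) gY] at hκY
  simp only [sum_marg_pair_right P gV gZ] at hκZ
  refine ⟨margLaw P gV, q, fun v u => κX (u, v), fun v u => κY (u, v), κZ, ?_, ?_⟩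
  · intro x u v
    rw [coe_margLaw, ← mul_assoc, ← hq, hq]
    exact hκX (u, v) x
  · rintro ⟨x, y, z⟩ u v
    rw [coe_margLaw, jointChannel, mulLaw_apply, mulLaw_apply]
    change marg P (fun ω => ((gX ω, gY ω, gZ ω), (gU ω, gV ω))) ((x, y, z), (u, v)) =
      marg P gV v * (q v u * (κX (u, v) x * (κY (u, v) y * κZ v z)))
    set J := marg P (fun ω => ((gX ω, gY ω, gZ ω), (gU ω, gV ω))) ((x, y, z), (u, v)) with hJ
    have hJ0 : 0 ≤ J := marg_nonneg hP0 _ _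
    have hJle : J ≤ marg P (fun ω => (gU ω, gV ω)) (u, v) := marg_pair_le_right hP0 _ _ _ _
    have hJ' : marg P (fun ω => ((gX ω, gY ω, gU ω), gV ω, gZ ω)) ((x, y, u), v, z) = J :=
      marg_congr P fun ω => by simp only [Prod.mk.injEq]; tauto
    have hA : marg P (fun ω => ((gX ω, gY ω, gU ω), gV ω)) ((x, y, u), v) =
        marg P (fun ω => (gX ω, (gU ω, gV ω), gY ω)) (x, (u, v), y) :=
      marg_congr P fun ω => by simp only [Prod.mk.injEq]; tauto
    have h₁ := hm₁' x (u, v) y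
    have h₂ := hm₂' (x, y, u) v z
    rw [hJ', hA, hκZ] at h₂
    rw [hκX (u, v) x, hκY (u, v) y, hq v u] at h₁
    rw [hq v u] at hJle
    generalize marg P (fun ω => (gX ω, (gU ω, gV ω), gY ω)) (x, (u, v), y) = a at h₁ h₂
    -- The Markov identities have cleared denominators, so they determine the factors only where
    -- `(u, v)` has positive mass; elsewhere both sides are `0`.
    by_cases h0 : marg P gV v * q v u = 0
    · rw [← mul_assoc, h0, zero_mul]
      exact le_antisymm (h0 ▸ hJle) hJ0
    · have hv : marg P gV v ≠ 0 := left_ne_zero_of_mul h0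
      have ha : a = marg P gV v * q v u * κX (u, v) x * κY (u, v) y := by
        apply mul_right_cancel₀ h0
        linear_combination h₁
      apply mul_right_cancel₀ hv
      rw [h₂, ha]
      ring

theorem innerBound_subset_synthesisRegion (QX : Law X) (W : X → Law (Y × Z)) :
    innerBound QX W ⊆ synthesisRegion QX W := by
  rintro ⟨R₀, R₁, R₂⟩ ⟨a, b, -, -, P, hP, h₀, h₁, h₂, h₃, h₄⟩
  obtain ⟨p, q, κX, κY, κZ, hX, hJ⟩ := exists_channels_of_mem_auxLaws hP
  have hout : ∀ w, outLaw p q (jointChannel κX κY κZ) w = targetLaw QX W w := fun w => by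
    rw [← hP.1]
    exact (marg_output_of_factorization P _ _ _ p q _ hJ w).symm
  have i₁ : info₁ p q κX ≤ R₁ := (mutualInfo_eq_info₁ P _ _ _ p q κX hX).symm.trans_le h₁
  have i₂ : info₂ p q κX ≤ R₂ := (mutualInfo_eq_info₂ P _ _ _ p q κX hX).symm.trans_le h₂
  have i₃ : info₁ p q (jointChannel κX κY κZ) ≤ R₁ + R₀ :=
    (mutualInfo_eq_info₁ P _ _ _ p q _ hJ).symm.trans_le h₃
  have i₄ : info₂ p q (jointChannel κX κY κZ) ≤ R₂ + R₀ :=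
    (mutualInfo_eq_info₂ P _ _ _ p q _ hJ).symm.trans_le h₄
  -- Nonnegativity of these rates is not part of `rateSet`; it comes from that of mutual
  -- information.
  have hR₁ : 0 ≤ R₁ := (mutualInfo_nonneg P _ _).trans h₁
  have hR₂ : 0 ≤ R₂ := (mutualInfo_nonneg P _ _).trans h₂
  change 0 ≤ R₀ at h₀
  refine mem_closure_of_forall_pos fun ε hε => ?_
  exact achievable_of_info_lt QX W p q κX κY κZ hout (by positivity) (by positivity)
    (by positivity) (by linarith) (by linarith) (by linarith) (by linarith)

end InnerBound

/-! ### The case of `X` independent of `(Y, Z)`. -/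

section Independent

variable {X Y Z V : Type*} [Fintype X] [Fintype Y] [Fintype Z] [Fintype V]

theorem targetLaw_eq_mul {QX : Law X} {W : X → Law (Y × Z)}
    (h : Indep (targetLaw QX W) (fun t => t.1) (fun t => t.2)) (x : X) (a : Y × Z) :
    targetLaw QX W (x, a) = QX x * marg (targetLaw QX W) (fun t => t.2) a := by
  have h₁ := h x a
  have h₂ : marg (targetLaw QX W) (fun t => (t.1, t.2)) (x, a) = targetLaw QX W (x, a) :=
    marg_of_injective (targetLaw QX W) Function.injective_id (x, a)
  have h₃ : marg (targetLaw QX W) (fun t => t.1) x = QX x := by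
    rw [← sum_marg_pair_right (targetLaw QX W) (fun t => t.1) (fun t => t.2) x]
    have : ∀ a, marg (targetLaw QX W) (fun t => (t.1, t.2)) (x, a) = QX x * W x a := fun a =>
      marg_of_injective (targetLaw QX W) Function.injective_id (x, a)
    simp only [this, ← Finset.mul_sum, law_sum, mul_one]
  rw [← h₂, h₁, h₃]

/-- A constant `Unit` satellite puts the law in the superposition format, so that the factorization
lemmas apply. -/
theorem exists_channels_of_markovChain {P : Law (Y × Z × V)}
    (hP : MarkovChain P (fun ω => ω.1) (fun ω => ω.2.2) (fun ω => ω.2.1)) :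
    ∃ (p : Law V) (κY : V → Law Y) (κZ : V → Law Z), ∀ w u v,
      marg P (fun ω => ((ω.1, ω.2.1), ((), ω.2.2))) (w, (u, v)) =
        p v * (uniformLaw Unit u * pairChannel κY κZ v u w) := by
  obtain ⟨⟨y₀, z₀, v₀⟩⟩ := law_nonempty P
  have : Nonempty Y := ⟨y₀⟩
  have : Nonempty Z := ⟨z₀⟩
  have hP0 := law_nonneg P
  set gV : Y × Z × V → V := fun ω => ω.2.2 with hgV
  obtain ⟨κY, hκY⟩ := exists_kernel
    (fun v y => marg P (fun ω => (ω.1, gV ω)) (y, v)) fun v y => marg_nonneg hP0 _ _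
  obtain ⟨κZ, hκZ⟩ := exists_kernel
    (fun v z => marg P (fun ω => (gV ω, ω.2.1)) (v, z)) fun v z => marg_nonneg hP0 _ _
  simp only [sum_marg_pair_left P (fun ω => ω.1) gV] at hκY
  simp only [sum_marg_pair_right P gV (fun ω => ω.2.1)] at hκZ
  refine ⟨margLaw P gV, κY, κZ, ?_⟩
  rintro ⟨y, z⟩ u v
  have h := hP y v z
  rw [hκY, hκZ] at h
  have hJ : marg P (fun ω => (ω.1, gV ω, ω.2.1)) (y, v, z) =
      marg P (fun ω => ((ω.1, ω.2.1), ((), gV ω))) ((y, z), (u, v)) :=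
    marg_congr P fun ω => by simp only [Prod.mk.injEq, true_and]; tauto
  rw [hJ] at h
  have hJle : marg P (fun ω => ((ω.1, ω.2.1), ((), gV ω))) ((y, z), (u, v)) ≤ marg P gV v :=
    (marg_pair_le_right hP0 _ _ _ _).trans (marg_pair_le_right hP0 _ _ _ _)
  have hJ0 : 0 ≤ marg P (fun ω => ((ω.1, ω.2.1), ((), gV ω))) ((y, z), (u, v)) :=
    marg_nonneg hP0 _ _
  have hu : uniformLaw Unit u = 1 := by simp [uniformLaw]
  rw [coe_margLaw, hu, one_mul, pairChannel, mulLaw_apply]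
  by_cases h0 : marg P gV v = 0
  · rw [h0, zero_mul]
    exact le_antisymm (h0 ▸ hJle) hJ0
  · apply mul_right_cancel₀ h0
    rw [h]
    ring

theorem mem_synthesisRegion_of_indep {QX : Law X} {W : X → Law (Y × Z)}
    (hind : Indep (targetLaw QX W) (fun t => t.1) (fun t => t.2)) (P : Law (Y × Z × V))
    (hPQ : marg P (fun ω => (ω.1, ω.2.1)) = marg (targetLaw QX W) (fun t => t.2))
    (hP : MarkovChain P (fun ω => ω.1) (fun ω => ω.2.2) (fun ω => ω.2.1)) {R₀ R₁ R₂ : ℝ}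
    (h₀ : 0 ≤ R₀) (h₁ : 0 ≤ R₁) (h₂ : 0 ≤ R₂)
    (h : mutualInfo P (fun ω => (ω.1, ω.2.1)) (fun ω => ω.2.2) ≤ R₂ + R₀) :
    (R₀, R₁, R₂) ∈ synthesisRegion QX W := by
  obtain ⟨p, κY, κZ, hJ⟩ := exists_channels_of_markovChain hP
  have hout : ∀ w, outLaw p (fun _ => uniformLaw Unit) (pairChannel κY κZ) w =
      marg (targetLaw QX W) (fun t => t.2) w := fun w => by
    rw [← hPQ]
    exact (marg_output_of_factorization P _ (fun _ => ()) _ p (fun _ => uniformLaw Unit) _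
      hJ w).symm
  have hinfo : info₁ p (fun _ => uniformLaw Unit) (pairChannel κY κZ) ≤ R₂ + R₀ := by
    have h' := mutualInfo_eq_info₂ P _ (fun _ => ()) _ p (fun _ => uniformLaw Unit) _ hJ
    refine le_trans (le_of_eq ?_) (h'.symm.trans_le h)
    -- With a constant satellite the centre channel is the channel itself, so both informations
    -- coincide.
    have : ∀ v u w, centreChannel (fun _ => uniformLaw Unit) (pairChannel κY κZ) v w =
        pairChannel κY κZ v u w := by
      intro v u w
      simp [centreChannel, uniformLaw]
    simp only [info₁, info₂, mean₃, mean₂, Finset.univ_unique, Finset.sum_singleton, this _ ()]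
  refine mem_closure_of_forall_pos fun ε hε => ?_
  exact achievable_of_indep QX W _ (targetLaw_eq_mul hind) p (fun _ => uniformLaw Unit) κY κZ hout
    (by positivity) (by positivity) (by positivity) (by linarith)

/-- The constraint on `R₁ + R₀ = 0` makes `(U, V)` independent of `(X, Y, Z)`. Conditioning on a
value of `V` then changes nothing, so conditional independence given `V` is plain independence. -/
theorem indep_of_mem_rateSet {U : Type*} [Fintype U] {QX : Law X} {W : X → Law (Y × Z)}
    {P : Law (X × Y × Z × U × V)} (hP : P ∈ auxLaws QX W U V) {R₂ : ℝ}
    (hR : ((0 : ℝ), (0 : ℝ), R₂) ∈ rateSet P) :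
    Indep (targetLaw QX W) (fun t => t.2.1) (fun t => t.2.2) := by
  obtain ⟨hQ, -, hm⟩ := hP
  obtain ⟨-, -, -, hI, -⟩ := hR
  have hind := indep_of_mutualInfo_nonpos P _ _ (hI.trans_eq (add_zero 0))
  have hV : Indep P (fun ω : X × Y × Z × U × V => (ω.1, ω.2.1, ω.2.2.1))
      (fun ω => ω.2.2.2.2) := (hind.symm.comp_left Prod.snd).symm
  have hY := hV.comp_left fun t => t.2.1
  have hZ := hV.comp_left fun t => t.2.2
  have hYZ := hV.comp_left fun t => (t.2.1, t.2.2)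
  have hmYZ := hm.comp_left fun t => t.2.1
  obtain ⟨v, hv⟩ : ∃ v, marg P (fun ω : X × Y × Z × U × V => ω.2.2.2.2) v ≠ 0 := by
    by_contra! h0
    have h1 := sum_marg P (fun ω : X × Y × Z × U × V => ω.2.2.2.2)
    rw [law_sum] at h1
    simp [h0] at h1
  intro y z
  rw [← hQ, marg_marg P, marg_marg P, marg_marg P]
  have e₁ := hY y v
  have e₂ := hZ.symm v z
  have e₃ := hYZ (y, z) v
  have e₄ := hmYZ y v z
  have e₅ : marg P (fun ω : X × Y × Z × U × V => (ω.2.1, ω.2.2.2.2, ω.2.2.1)) (y, v, z) =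
      marg P (fun ω => ((ω.2.1, ω.2.2.1), ω.2.2.2.2)) ((y, z), v) :=
    marg_congr P fun ω => by simp only [Prod.mk.injEq]; tauto
  have e₆ : marg P (fun ω : X × Y × Z × U × V => (ω.2.1, ω.2.2.2.2, ω.2.2.1)) (y, v, z) *
      marg P (fun ω => ω.2.2.2.2) v = marg P (fun ω => (ω.2.1, ω.2.2.2.2)) (y, v) *
        marg P (fun ω => (ω.2.2.2.2, ω.2.2.1)) (v, z) := e₄
  rw [e₅, e₃, e₁, e₂] at e₆
  have e₇ : marg P (fun ω : X × Y × Z × U × V => (ω.2.1, ω.2.2.1)) (y, z) =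
      marg P (fun ω => ω.2.1) y * marg P (fun ω => ω.2.2.1) z := by
    -- The Markov identity at `v` now carries the mass of `v` twice on each side.
    apply mul_right_cancel₀ hv
    apply mul_right_cancel₀ hv
    linear_combination e₆
  exact e₇

/-- The choice `V = e Y` gives a joint law of `(Y, Z, V)` with `Y - V - Z`. -/
theorem exists_law_of_copy (QX : Law X) (W : X → Law (Y × Z)) {e : Y → V}
    (he : Function.Injective e) : ∃ P : Law (Y × Z × V),
      marg P (fun ω => (ω.1, ω.2.1)) = marg (targetLaw QX W) (fun t => t.2) ∧
      MarkovChain P (fun ω => ω.1) (fun ω => ω.2.2) (fun ω => ω.2.1) := by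
  have h1 : ∑ t, targetLaw QX W t = 1 := by
    rw [Fintype.sum_prod_type]
    simp only [targetLaw, ← Finset.mul_sum, law_sum, mul_one]
  set Q : Law (X × Y × Z) := mkLaw (targetLaw QX W)
    (fun t => mul_nonneg (law_nonneg _ _) (law_nonneg _ _)) h1
  refine ⟨margLaw Q fun t => (t.2.1, t.2.2, e t.2.1), ?_, ?_⟩
  · rw [coe_margLaw, marg_marg]
    rfl
  · have h := markovChain_of_injective (targetLaw QX W) (fun t => t.2.1) he (fun t => t.2.2)
    intro y v z
    simp only [coe_margLaw, marg_marg]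
    exact h y v z

theorem exists_mem_synthesisRegion_notMem_rateSet {QX : Law X} {W : X → Law (Y × Z)}
    (hind : Indep (targetLaw QX W) (fun t => t.1) (fun t => t.2))
    (hdep : ¬ Indep (targetLaw QX W) (fun t => t.2.1) (fun t => t.2.2)) :
    ∃ R₂ : ℝ, 0 < R₂ ∧ ((0 : ℝ), (0 : ℝ), R₂) ∈ synthesisRegion QX W ∧
      ∀ (a b : ℕ), ∀ P ∈ auxLaws QX W (Fin a) (Fin b), ((0 : ℝ), (0 : ℝ), R₂) ∉ rateSet P := by
  obtain ⟨P, hPQ, hP⟩ := exists_law_of_copy QX W (Function.injective_id (α := Y))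
  set I := mutualInfo P (fun ω => (ω.1, ω.2.1)) (fun ω => ω.2.2)
  -- Any positive number at least `I` would do.
  refine ⟨|I| + 1, by positivity, ?_, fun a b P hP hR => hdep (indep_of_mem_rateSet hP hR)⟩
  exact mem_synthesisRegion_of_indep hind P hPQ hP le_rfl le_rfl (by positivity)
    (by linarith [le_abs_self I])

end Independent

/-! ### Binary example: `Y = Z` a uniform bit, `X` an independent uniform bit. -/

section Binary

/-- The law of a pair of equal uniform bits. -/
def equalBits : Law (Bool × Bool) :=
  mkLaw (fun a => if a.1 = a.2 then 1 / 2 else 0) (fun a => by split_ifs <;> norm_num)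
    (by rw [Fintype.sum_prod_type]; simp)

theorem innerBound_ssubset_of_dependent {X Y Z : Type*} [Fintype X] [Fintype Y] [Fintype Z]
    {QX : Law X} {W : X → Law (Y × Z)}
    (hind : Indep (targetLaw QX W) (fun t => t.1) (fun t => t.2))
    (hdep : ¬ Indep (targetLaw QX W) (fun t => t.2.1) (fun t => t.2.2)) :
    innerBound QX W ⊂ synthesisRegion QX W := by
  obtain ⟨R₂, -, hR, hnot⟩ := exists_mem_synthesisRegion_notMem_rateSet hind hdep
  refine ⟨innerBound_subset_synthesisRegion QX W, fun hsub => ?_⟩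
  obtain ⟨a, b, -, -, P, hP, hPR⟩ := hsub hR
  exact hnot a b P hP hPR

theorem indep_equalBits :
    Indep (targetLaw (uniformLaw Bool) fun _ => equalBits) (fun t => t.1) (fun t => t.2) := by
  rintro x ⟨y, z⟩
  cases x <;> cases y <;> cases z <;>
    simp [marg, targetLaw, uniformLaw, equalBits, Fintype.sum_prod_type]

theorem not_indep_equalBits :
    ¬ Indep (targetLaw (uniformLaw Bool) fun _ => equalBits) (fun t => t.2.1)
      (fun t => t.2.2) := by
  intro h
  have := h true false
  simp [marg, targetLaw, uniformLaw, equalBits, Fintype.sum_prod_type] at this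

end Binary

end CascadeSynthesis

end

theorem mainTheorem3 {X Y Z : Type*} [Fintype X] [Fintype Y] [Fintype Z]
    (QX : CascadeSynthesis.Law X) (W : X → CascadeSynthesis.Law (Y × Z)) :
    -- every rate triple of the inner bound lies in the region without an eavesdropper
    CascadeSynthesis.innerBound QX W ⊆ CascadeSynthesis.synthesisRegion QX W ∧
    -- if `X` is independent of `(Y, Z)`, the constraint on `R₂ + R₀` alone is sufficient
    (CascadeSynthesis.Indep (CascadeSynthesis.targetLaw QX W) (fun t => t.1) (fun t => t.2) →
      ∀ (b : ℕ) (P : CascadeSynthesis.Law (Y × Z × Fin b)),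
        CascadeSynthesis.marg P (fun (y, z, _) => (y, z)) =
          CascadeSynthesis.marg (CascadeSynthesis.targetLaw QX W) (fun t => t.2) →
        CascadeSynthesis.MarkovChain P (fun (y, _, _) => y) (fun (_, _, v) => v)
          (fun (_, z, _) => z) →
        ∀ R₀ R₁ R₂ : ℝ, 0 ≤ R₀ → 0 ≤ R₁ → 0 ≤ R₂ →
          CascadeSynthesis.mutualInfo P (fun (y, z, _) => (y, z)) (fun (_, _, v) => v) ≤ R₂ + R₀ →
          (R₀, R₁, R₂) ∈ CascadeSynthesis.synthesisRegion QX W) ∧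
    -- if moreover `Y` and `Z` are dependent, some triple with `R₀ = R₁ = 0 < R₂` lies in the
    -- region, but is not allowed by the inner bound, whatever the finite auxiliary alphabets
    (CascadeSynthesis.Indep (CascadeSynthesis.targetLaw QX W) (fun t => t.1) (fun t => t.2) →
      ¬ CascadeSynthesis.Indep (CascadeSynthesis.targetLaw QX W)
          (fun t => t.2.1) (fun t => t.2.2) →
      ∃ R₂ : ℝ, 0 < R₂ ∧ ((0 : ℝ), (0 : ℝ), R₂) ∈ CascadeSynthesis.synthesisRegion QX W ∧
        ∀ (a b : ℕ), ∀ P ∈ CascadeSynthesis.auxLaws QX W (Fin a) (Fin b),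
          ((0 : ℝ), (0 : ℝ), R₂) ∉ CascadeSynthesis.rateSet P) ∧
    -- so the inner bound is not optimal: there is a binary example where it is strictly smaller
    (∃ (QX' : CascadeSynthesis.Law Bool) (W' : Bool → CascadeSynthesis.Law (Bool × Bool)),
      CascadeSynthesis.Indep (CascadeSynthesis.targetLaw QX' W') (fun t => t.1) (fun t => t.2) ∧
      CascadeSynthesis.innerBound QX' W' ⊂ CascadeSynthesis.synthesisRegion QX' W') := by
  refine ⟨CascadeSynthesis.innerBound_subset_synthesisRegion QX W, ?_,
    CascadeSynthesis.exists_mem_synthesisRegion_notMem_rateSet,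
    CascadeSynthesis.uniformLaw Bool, fun _ => CascadeSynthesis.equalBits,
    CascadeSynthesis.indep_equalBits,
    CascadeSynthesis.innerBound_ssubset_of_dependent CascadeSynthesis.indep_equalBits
      CascadeSynthesis.not_indep_equalBits⟩
  intro hind b P hPQ hP R₀ R₁ R₂ h₀ h₁ h₂ h
  exact CascadeSynthesis.mem_synthesisRegion_of_indep hind P hPQ hP h₀ h₁ h₂ h
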